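/- **Theorem (Green).** Let $\mathcal C$ be an abelian category which is * *finitary*: for all objects $A,A'$, the set $\mathrm{Hom}(A',A)$ and the set of equivalence classes of extensions $0\to A\to X\to A'\to 0$ are finite; * *cofinitary*: every object has only finitely many subobjects; * *hereditary*: $\mathrm{Ext}^i(A,B)=0$ for all objects $A,B$ and all $i>1$. For a groupoid $\mathcal A$ let $\mathcal F(\mathcal A)$ be the $\mathbb Q$-vector space of functions $\varphi:\mathrm{ob}\,\mathcal A\to\mathbb Q$ that are constant on isomorphism classes and nonzero on only finitely many isomorphism classes; identify $\mathcal F(\mathcal A)\otimes\mathcal F(\mathcal B)$ with $\mathcal F(\mathcal A\times\mathcal B)$ through $(\varphi\otimes\psi)(a,b)=\varphi(a)\psi(b)$. For a functor $F:\mathcal A\to\mathcal B$ of groupoids, put $(F^*\varphi)(a)=\varphi(F(a))$ if $F$ is $\pi_0$-finite (that is, $\pi_0(\mathcal A)\to\pi_0(\mathcal B)$ has finite fibers), and $$(F_!\varphi)(b)=\sum_{[(a,\,F(a)\cong b)]\in\pi_0(\mathcal A_b)}\frac{\varphi(a)}{|\mathrm{Aut}_{\mathcal A_b}(a,\,F(a)\cong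 b)|}$$ if $F$ is locally finite, where $\mathcal A_b$ is the $2$-fiber of $F$ at $b$. ($F$ is locally finite if its restriction to every connected component of $\mathcal A$ has $2$-fibers with finitely many isomorphism classes and finite automorphism groups.) Let $\mathcal S_1$ be the groupoid of objects of $\mathcal C$ and $\mathcal S_2$ the groupoid of short exact sequences $A\to B\to A'$ in $\mathcal C$, with isomorphisms as morphisms. Let $F:\mathcal S_2\to\mathcal S_1$ and $G,G':\mathcal S_2\to\mathcal S_1\times\mathcal S_1$ send $A\to B\to A'$ to $B$, $(A,A')$ and $(A',A)$, respectively. Then $F$ and $G$ are $\pi_0$-finite and $F$ and $G'$ are locally finite. Put $H=\mathcal F(\mathcal S_1)$, and define the multiplication and the comultiplication $$\mu=F_!\,G^*:H\otimes H\to H,\qquad \Delta'=G'_!\,F^*:H\to H\otimes H.$$ Let $\mathbb 1_A\in H$ be the function with value $1$ on the objects isomorphic to $A$ and $0$ elsewhere, and write $xy=\mu(x\otimes y)$. Let the twisted multiplication $\mu^t:(H\otimes H)\otimes(H\otimes H)\to H\otimes H$ be the $\mathbb Q$-linear map with $$\mu^t\big((\mathbb 1_A\otimes\mathbb 1_B)\otimes(\mathbb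 1_{A'}\otimes\mathbb 1_{B'})\big)=\frac{|\mathrm{Ext}^1(A',B)|}{|\mathrm{Hom}(A',B)|}\;(\mathbb 1_A\mathbb 1_{A'})\otimes(\mathbb 1_B\mathbb 1_{B'}).$$ Then $\Delta'$ is multiplicative with respect to $\mu$ and $\mu^t$: $$\mu^t\circ(\Delta'\otimes\Delta')=\Delta'\circ\mu .$$ -/

import Mathlib

open CategoryTheory CategoryTheory.Limits CategoryTheory.Abelian
open scoped TensorProduct

universe w v u v₁ u₁ v₂ u₂

namespace HallGreen

noncomputable section

section Groupoids

/-- The set `π₀(A)` of isomorphism classes of objects. -/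
abbrev Pi0 (A : Type u₁) [Category.{v₁} A] : Type u₁ := Quotient (isIsomorphicSetoid A)

/-- The isomorphism class of an object. -/
abbrev Pi0.mk {A : Type u₁} [Category.{v₁} A] (a : A) : Pi0 A :=
  Quotient.mk (isIsomorphicSetoid A) a

lemma Pi0.mk_eq_iff {A : Type u₁} [Category.{v₁} A] {a a' : A} :
    Pi0.mk a = Pi0.mk a' ↔ Nonempty (a ≅ a') := Quotient.eq

lemma Pi0.mk_out {A : Type u₁} [Category.{v₁} A] (c : Pi0 A) : Pi0.mk c.out = c :=
  Quotient.out_eq c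

lemma Pi0.out_iso {A : Type u₁} [Category.{v₁} A] (a : A) : Nonempty ((Pi0.mk a).out ≅ a) :=
  Pi0.mk_eq_iff.1 (Pi0.mk_out _)

/-- The map of sets of isomorphism classes induced by a functor. -/
def Pi0.map {A : Type u₁} [Category.{v₁} A] {B : Type u₂} [Category.{v₂} B] (F : A ⥤ B) :
    Pi0 A → Pi0 B :=
  Quotient.map' F.obj (fun _ _ ⟨e⟩ => ⟨F.mapIso e⟩)

lemma Pi0.map_mk {A : Type u₁} [Category.{v₁} A] {B : Type u₂} [Category.{v₂} B] (F : A ⥤ B)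
    (a : A) : Pi0.map F (Pi0.mk a) = Pi0.mk (F.obj a) := rfl

/-- A groupoid is finite if it has finitely many isomorphism classes of objects and all
automorphism groups are finite. -/
structure FiniteGroupoid (A : Type u₁) [Category.{v₁} A] : Prop where
  finite_pi0 : Finite (Pi0 A)
  finite_aut : ∀ a : A, Finite (Aut a)

/-- The groupoid integral `∑_{[a] ∈ π₀(A)} φ(a) / |Aut(a)|`. -/
def integral {A : Type u₁} [Category.{v₁} A] (φ : A → ℚ) : ℚ :=
  ∑ᶠ c : Pi0 A, φ c.out / (Nat.card (Aut c.out) : ℚ)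

/-- The 2-fiber of a functor of groupoids `F : A ⥤ B` at `b`: objects are pairs consisting of
`a : A` and a (necessarily invertible) morphism `F a ⟶ b`; morphisms are morphisms in `A`
compatible with the structure morphisms to `b`. -/
abbrev TwoFiber {A : Type u₁} [Groupoid.{v₁} A] {B : Type u₂} [Groupoid.{v₂} B]
    (F : A ⥤ B) (b : B) := CostructuredArrow F b

/-- A functor of groupoids is finite if all its 2-fibers are finite. -/
def FiniteFunctor {A : Type u₁} [Groupoid.{v₁} A] {B : Type u₂} [Groupoid.{v₂} B]
    (F : A ⥤ B) : Prop :=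
  ∀ b : B, FiniteGroupoid (TwoFiber F b)

/-- The connected component `A(a)`: the full subgroupoid on the objects isomorphic to `a`. -/
abbrev Component (A : Type u₁) [Groupoid.{v₁} A] (a : A) : Type u₁ :=
  ObjectProperty.FullSubcategory (fun x : A => Nonempty (x ≅ a))

instance (A : Type u₁) [Groupoid.{v₁} A] (a : A) : Groupoid.{v₁} (Component A a) :=
  Groupoid.ofFullyFaithfulToGroupoid (ObjectProperty.ι (fun x : A => Nonempty (x ≅ a)))
    (ObjectProperty.fullyFaithfulι _)

/-- The inclusion of a connected component. -/
abbrev Component.incl (A : Type u₁) [Groupoid.{v₁} A] (a : A) : Component A a ⥤ A :=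
  ObjectProperty.ι (fun x : A => Nonempty (x ≅ a))

/-- A functor of groupoids is locally finite if its restriction to every connected component of
the source is finite. -/
def LocallyFinite {A : Type u₁} [Groupoid.{v₁} A] {B : Type u₂} [Groupoid.{v₂} B]
    (F : A ⥤ B) : Prop :=
  ∀ a : A, FiniteFunctor (Component.incl A a ⋙ F)

/-- A functor is `π₀`-finite if the induced map on isomorphism classes has finite fibers. -/
def Pi0Finite {A : Type u₁} [Groupoid.{v₁} A] {B : Type u₂} [Groupoid.{v₂} B]
    (F : A ⥤ B) : Prop :=
  ∀ c : Pi0 B, {x : Pi0 A | Pi0.map F x = c}.Finite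

/-- The `ℚ`-vector space `𝓕(A)` of functions on the objects of `A` which are constant on
isomorphism classes and nonzero on only finitely many isomorphism classes. -/
def GFun (A : Type u₁) [Groupoid.{v₁} A] : Submodule ℚ (A → ℚ) where
  carrier := {φ | (∀ a a' : A, Nonempty (a ≅ a') → φ a = φ a') ∧
    {c : Pi0 A | ∃ a : A, Pi0.mk a = c ∧ φ a ≠ 0}.Finite}
  zero_mem' := ⟨fun _ _ _ => rfl, by simp⟩
  add_mem' := by
    rintro φ ψ ⟨h1, h2⟩ ⟨h3, h4⟩
    refine ⟨fun a a' h => by simp [h1 a a' h, h3 a a' h], (h2.union h4).subset ?_⟩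
    rintro c ⟨a, rfl, ha⟩
    by_cases h : φ a = 0
    · exact Or.inr ⟨a, rfl, by simpa [h] using ha⟩
    · exact Or.inl ⟨a, rfl, h⟩
  smul_mem' := by
    rintro r φ ⟨h1, h2⟩
    refine ⟨fun a a' h => by simp [h1 a a' h], h2.subset ?_⟩
    rintro c ⟨a, rfl, ha⟩
    exact ⟨a, rfl, by simp_all⟩

lemma GFun.congr {A : Type u₁} [Groupoid.{v₁} A] (φ : GFun A) {a a' : A} (e : a ≅ a') :
    φ.1 a = φ.1 a' := φ.2.1 a a' ⟨e⟩

lemma GFun.finite_support {A : Type u₁} [Groupoid.{v₁} A] (φ : GFun A) :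
    {c : Pi0 A | φ.1 c.out ≠ 0}.Finite :=
  φ.2.2.subset fun c hc => ⟨c.out, Pi0.mk_out c, hc⟩

lemma integral_equivalence {A : Type u₁} [Category.{v₁} A] {B : Type u₂} [Category.{v₂} B]
    (e : A ≌ B) (φ : B → ℚ) (hφ : ∀ b b' : B, Nonempty (b ≅ b') → φ b = φ b') :
    integral (fun a => φ (e.functor.obj a)) = integral φ := by
  refine finsum_eq_of_bijective (Pi0.map e.functor) ⟨?_, ?_⟩ ?_
  · intro c c'
    induction c using Quotient.inductionOn with | _ a
    induction c' using Quotient.inductionOn with | _ a'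
    intro h
    obtain ⟨i⟩ := Pi0.mk_eq_iff.1 h
    exact Pi0.mk_eq_iff.2 ⟨e.functor.preimageIso i⟩
  · intro c
    induction c using Quotient.inductionOn with | _ b
    exact ⟨Pi0.mk (e.inverse.obj b), Pi0.mk_eq_iff.2 ⟨e.counitIso.app b⟩⟩
  · intro c
    have h : Pi0.map e.functor c = Pi0.mk (e.functor.obj c.out) := by
      conv_lhs => rw [← Pi0.mk_out c]
      rfl
    rw [h]
    obtain ⟨i⟩ := Pi0.out_iso (e.functor.obj c.out)
    have h1 := hφ _ _ ⟨i⟩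
    have h2 : Nat.card (Aut c.out) = Nat.card (Aut (Pi0.mk (e.functor.obj c.out)).out) :=
      Nat.card_congr ((e.fullyFaithfulFunctor.autMulEquivOfFullyFaithful c.out).toEquiv.trans
        (Aut.autMulEquivOfIso i.symm).toEquiv)
    simp only [h1, h2]

/-- Pullback of functions along a `π₀`-finite functor: `(F^* φ)(a) = φ(F a)`. -/
def pullback {A : Type u₁} [Groupoid.{v₁} A] {B : Type u₂} [Groupoid.{v₂} B] (F : A ⥤ B)
    (hF : Pi0Finite F) : GFun B →ₗ[ℚ] GFun A where
  toFun φ := ⟨fun a => φ.1 (F.obj a), fun _ _ ⟨e⟩ => GFun.congr φ (F.mapIso e), by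
    refine (φ.2.2.biUnion fun c _ => hF c).subset ?_
    rintro _ ⟨a, rfl, ha⟩
    exact Set.mem_biUnion (x := Pi0.mk (F.obj a)) ⟨F.obj a, rfl, ha⟩ rfl⟩
  map_add' _ _ := rfl
  map_smul' _ _ := rfl

lemma LocallyFinite.finite_support {A : Type u₁} [Groupoid.{v₁} A] {B : Type u₂}
    [Groupoid.{v₂} B] {F : A ⥤ B} (hF : LocallyFinite F) (φ : GFun A) (b : B) :
    (Function.support fun c : Pi0 (TwoFiber F b) =>
      φ.1 c.out.left / (Nat.card (Aut c.out) : ℚ)).Finite := by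
  refine (φ.2.2.biUnion (t := fun t => Set.range (Pi0.map
    (CostructuredArrow.pre (Component.incl A t.out) F b))) fun t _ => ?_).subset ?_
  · have := (hF t.out b).finite_pi0
    exact Set.finite_range _
  · intro c hc
    have hc' : φ.1 c.out.left ≠ 0 := fun h => hc (by simp [h])
    refine Set.mem_biUnion (x := Pi0.mk c.out.left) ⟨_, rfl, hc'⟩ ?_
    obtain ⟨i⟩ := Pi0.out_iso c.out.left
    let x : Component A (Pi0.mk c.out.left).out := ⟨c.out.left, ⟨i.symm⟩⟩
    refine ⟨Pi0.mk (CostructuredArrow.mk (S := Component.incl A _ ⋙ F) (Y := x) c.out.hom), ?_⟩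
    rw [Pi0.map_mk]
    conv_rhs => rw [← Pi0.mk_out c]
    exact Pi0.mk_eq_iff.2 ⟨CostructuredArrow.isoMk (Iso.refl _)⟩

/-- Pushforward of functions along a locally finite functor: `(F_! φ)(b)` is the groupoid
integral over the 2-fiber of `F` at `b` of the restriction of `φ`. -/
def pushforward {A : Type u₁} [Groupoid.{v₁} A] {B : Type u₂} [Groupoid.{v₂} B] (F : A ⥤ B)
    (hF : LocallyFinite F) : GFun A →ₗ[ℚ] GFun B where
  toFun φ := ⟨fun b => integral fun x : TwoFiber F b => φ.1 x.left, by
    rintro b b' ⟨e⟩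
    refine integral_equivalence (CostructuredArrow.mapIso (S := F) e)
      (fun x : TwoFiber F b' => φ.1 x.left) ?_
    rintro x y ⟨i⟩
    exact GFun.congr φ ((CostructuredArrow.proj F b').mapIso i), by
    refine (φ.2.2.image (Pi0.map F)).subset ?_
    rintro _ ⟨b, rfl, hb⟩
    obtain ⟨c, hc⟩ : ∃ c : Pi0 (TwoFiber F b), φ.1 c.out.left / (Nat.card (Aut c.out) : ℚ) ≠ 0 := by
      by_contra! h
      exact hb ((finsum_congr h).trans finsum_zero)
    refine ⟨Pi0.mk c.out.left, ⟨_, rfl, fun h => hc (by simp [h])⟩, ?_⟩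
    exact Pi0.mk_eq_iff.2 ⟨asIso c.out.hom⟩⟩
  map_add' φ ψ := by
    ext b
    change integral (fun x : TwoFiber F b => φ.1 x.left + ψ.1 x.left) =
      integral (fun x : TwoFiber F b => φ.1 x.left) + integral (fun x : TwoFiber F b => ψ.1 x.left)
    unfold integral
    rw [← finsum_add_distrib (hF.finite_support φ b) (hF.finite_support ψ b)]
    exact finsum_congr fun c => add_div _ _ _
  map_smul' r φ := by
    ext b
    change integral (fun x : TwoFiber F b => r * φ.1 x.left) =
      r * integral (fun x : TwoFiber F b => φ.1 x.left)
    unfold integral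
    rw [mul_finsum' (h := hF.finite_support φ b)]
    exact finsum_congr fun c => mul_div_assoc _ _ _

/-- The linear map `R_! ∘ L^*` attached to a span of groupoids `A ← X → B` with `L`
`π₀`-finite and `R` locally finite. -/
def spanMap {X : Type u} [Groupoid.{v} X] {A : Type u₁} [Groupoid.{v₁} A] {B : Type u₂}
    [Groupoid.{v₂} B] (L : X ⥤ A) (R : X ⥤ B) (hL : Pi0Finite L) (hR : LocallyFinite R) :
    GFun A →ₗ[ℚ] GFun B :=
  pushforward R hR ∘ₗ pullback L hL

/-- The function `𝟙_a`, with value `1` on the objects isomorphic to `a` and `0` elsewhere. -/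
def indicator {A : Type u₁} [Groupoid.{v₁} A] (a : A) : GFun A :=
  ⟨fun x => open Classical in if Nonempty (x ≅ a) then 1 else 0, by
    rintro x y ⟨e⟩
    have : Nonempty (x ≅ a) ↔ Nonempty (y ≅ a) :=
      ⟨fun ⟨i⟩ => ⟨e.symm ≪≫ i⟩, fun ⟨i⟩ => ⟨e ≪≫ i⟩⟩
    by_cases h : Nonempty (y ≅ a) <;> simp [this, h], by
    refine (Set.finite_singleton (Pi0.mk a)).subset ?_
    rintro _ ⟨x, rfl, hx⟩
    exact Pi0.mk_eq_iff.2 (by by_contra h; simp [h] at hx)⟩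

/-- Functions in `𝓕(A)` are the finitely supported functions on `π₀(A)`. -/
def toFinsupp (A : Type u₁) [Groupoid.{v₁} A] : GFun A ≃ₗ[ℚ] (Pi0 A →₀ ℚ) where
  toFun φ := Finsupp.ofSupportFinite (fun c => φ.1 c.out) (GFun.finite_support φ)
  invFun f := ⟨fun a => f (Pi0.mk a), fun a a' h => congrArg f (Pi0.mk_eq_iff.2 h), by
    refine f.hasFiniteSupport.subset ?_
    rintro _ ⟨a, rfl, ha⟩
    exact ha⟩
  map_add' _ _ := by ext; rfl
  map_smul' _ _ := by ext; rfl
  left_inv φ := by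
    ext a
    exact GFun.congr φ (Pi0.out_iso a).some
  right_inv f := by
    ext c
    exact congrArg f (Pi0.mk_out c)

/-- The basis of `𝓕(A)` indexed by `π₀(A)`. -/
def indicatorBasis (A : Type u₁) [Groupoid.{v₁} A] : Module.Basis (Pi0 A) ℚ (GFun A) :=
  .ofRepr (toFinsupp A)

lemma indicatorBasis_mk {A : Type u₁} [Groupoid.{v₁} A] (a : A) :
    indicatorBasis A (Pi0.mk a) = indicator a := by
  classical
  ext x
  change (Finsupp.single (Pi0.mk a) (1 : ℚ)) (Pi0.mk x) = if Nonempty (x ≅ a) then 1 else 0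
  rw [Finsupp.single_apply]
  congr 1
  rw [eq_comm (a := Pi0.mk a)]
  exact propext Pi0.mk_eq_iff

/-- Isomorphism classes in a product. -/
def pi0Prod (A : Type u₁) [Groupoid.{v₁} A] (B : Type u₂) [Groupoid.{v₂} B] :
    Pi0 A × Pi0 B ≃ Pi0 (A × B) where
  toFun p := Quotient.map₂ (sa := isIsomorphicSetoid A) (sb := isIsomorphicSetoid B)
    (sc := isIsomorphicSetoid (A × B)) (fun a b => (a, b))
    (fun _ _ ⟨e⟩ _ _ ⟨e'⟩ => ⟨e.prod e'⟩) p.1 p.2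
  invFun c := (Pi0.map (CategoryTheory.Prod.fst A B) c, Pi0.map (CategoryTheory.Prod.snd A B) c)
  left_inv := by
    rintro ⟨c, c'⟩
    induction c using Quotient.inductionOn
    induction c' using Quotient.inductionOn
    rfl
  right_inv c := by
    induction c using Quotient.inductionOn
    rfl

/-- The canonical isomorphism `𝓕(A) ⊗ 𝓕(B) ≅ 𝓕(A × B)`, which sends `φ ⊗ ψ` to the function
`(a, b) ↦ φ(a) ψ(b)` (see `tensorEquiv_tmul_apply`). -/
def tensorEquiv (A : Type u₁) [Groupoid.{v₁} A] (B : Type u₂) [Groupoid.{v₂} B] :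
    GFun A ⊗[ℚ] GFun B ≃ₗ[ℚ] GFun (A × B) :=
  TensorProduct.congr (toFinsupp A) (toFinsupp B) ≪≫ₗ finsuppTensorFinsupp' ℚ (Pi0 A) (Pi0 B) ≪≫ₗ
    Finsupp.domLCongr (pi0Prod A B) ≪≫ₗ (toFinsupp (A × B)).symm

lemma tensorEquiv_tmul_apply {A : Type u₁} [Groupoid.{v₁} A] {B : Type u₂} [Groupoid.{v₂} B]
    (φ : GFun A) (ψ : GFun B) (a : A) (b : B) :
    (tensorEquiv A B (φ ⊗ₜ[ℚ] ψ)).1 (a, b) = φ.1 a * ψ.1 b := by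
  have h : (pi0Prod A B).symm (Pi0.mk (a, b)) = (Pi0.mk a, Pi0.mk b) := rfl
  change (Finsupp.domLCongr (R := ℚ) (M := ℚ) (pi0Prod A B) (finsuppTensorFinsupp' ℚ (Pi0 A) (Pi0 B)
    (toFinsupp A φ ⊗ₜ[ℚ] toFinsupp B ψ))) (Pi0.mk (a, b)) = _
  rw [Finsupp.domLCongr_apply, Finsupp.domCongr_apply, Finsupp.equivMapDomain_apply, h,
    finsuppTensorFinsupp'_apply_apply]
  exact congrArg₂ _ (GFun.congr φ (Pi0.out_iso a).some) (GFun.congr ψ (Pi0.out_iso b).some)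

lemma locallyFinite_of_finite_hom {A : Type u₁} [Groupoid.{v₁} A] {B : Type u₂}
    [Groupoid.{v₂} B] (F : A ⥤ B) (hA : ∀ a : A, Finite (a ⟶ a))
    (hB : ∀ b b' : B, Finite (b ⟶ b')) : LocallyFinite F := by
  intro a b
  refine ⟨?_, fun x => ?_⟩
  · have := hB (F.obj a) b
    let a₀ : Component A a := ⟨a, ⟨Iso.refl a⟩⟩
    refine Finite.of_surjective (fun g : F.obj a ⟶ b =>
      Pi0.mk (CostructuredArrow.mk (S := Component.incl A a ⋙ F) (Y := a₀) g)) ?_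
    intro c
    induction c using Quotient.inductionOn with | _ x
    obtain ⟨i⟩ := x.left.property
    let j : a₀ ≅ x.left := (ObjectProperty.fullyFaithfulι _).preimageIso i.symm
    refine ⟨(Component.incl A a ⋙ F).map j.hom ≫ x.hom, Pi0.mk_eq_iff.2 ?_⟩
    exact ⟨CostructuredArrow.isoMk j⟩
  · have := hA x.left.obj
    refine Finite.of_injective (fun f : Aut x => (Component.incl A a).map f.hom.left) ?_
    intro f g h
    exact Iso.ext (CostructuredArrow.hom_ext _ _ ((Component.incl A a).map_injective h))

end Groupoids

section HallAlgebra

variable (C : Type u) [Category.{v} C] [Abelian C]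

/-- An extension of `A'` by `A`: a short exact sequence `0 ⟶ A ⟶ X ⟶ A' ⟶ 0`. -/
structure Extension (A' A : C) where
  X : C
  i : A ⟶ X
  p : X ⟶ A'
  zero : i ≫ p = 0
  shortExact : (ShortComplex.mk i p zero).ShortExact

/-- Two extensions are equivalent if there is an isomorphism of their middle terms compatible
with the identities of `A` and `A'`. -/
def extensionSetoid (A' A : C) : Setoid (Extension C A' A) where
  r E E' := ∃ e : E.X ≅ E'.X, E.i ≫ e.hom = E'.i ∧ e.hom ≫ E'.p = E.p
  iseqv :=
    { refl := fun E => ⟨Iso.refl _, by simp, by simp⟩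
      symm := by
        rintro E E' ⟨e, h1, h2⟩
        exact ⟨e.symm, by simp [← h1], by simp [← h2]⟩
      trans := by
        rintro E E' E'' ⟨e, h1, h2⟩ ⟨e', h3, h4⟩
        exact ⟨e ≪≫ e', by simp [reassoc_of% h1, h3], by simp [h4, h2]⟩ }

/-- The set of equivalence classes of extensions of `A'` by `A`. -/
def ExtensionClasses (A' A : C) : Type (max u v) := Quotient (extensionSetoid C A' A)

/-- `C` is finitary: all sets of morphisms and all sets of equivalence classes of extensions are
finite. -/
class IsFinitary : Prop where
  finite_hom : ∀ A' A : C, Finite (A' ⟶ A)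
  finite_ext : ∀ A' A : C, Finite (ExtensionClasses C A' A)

/-- `C` is cofinitary: every object has only finitely many subobjects. -/
class IsCofinitary : Prop where
  finite_subobject : ∀ X : C, Finite (Subobject X)

/-- `C` is hereditary: `Ext^i(A, B) = 0` for all objects `A`, `B` and all `i > 1`. -/
class IsHereditary [HasExt.{w} C] : Prop where
  subsingleton_ext : ∀ (A B : C) (i : ℕ), 1 < i → Subsingleton (Ext.{w} A B i)

/-- The groupoid `S₁` of objects of `C`. -/
abbrev S1 : Type u := Core C

/-- The category of short exact sequences in `C`. -/
abbrev ShortExactSequence : Type (max u v) :=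
  ObjectProperty.FullSubcategory (fun S : ShortComplex C => S.ShortExact)

/-- The groupoid `S₂` of short exact sequences in `C`. -/
abbrev S2 : Type (max u v) := Core (ShortExactSequence C)

/-- The forgetful functor from short exact sequences to all short complexes. -/
abbrev seqIncl : ShortExactSequence C ⥤ ShortComplex C :=
  ObjectProperty.ι (fun S : ShortComplex C => S.ShortExact)

/-- The functor sending `A ⟶ B ⟶ A'` to `A`. -/
abbrev subFunctor : S2 C ⥤ S1 C := (seqIncl C ⋙ ShortComplex.π₁).core

/-- The functor `F : S₂ ⥤ S₁` sending `A ⟶ B ⟶ A'` to `B`. -/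
abbrev midFunctor : S2 C ⥤ S1 C := (seqIncl C ⋙ ShortComplex.π₂).core

/-- The functor sending `A ⟶ B ⟶ A'` to `A'`. -/
abbrev quotFunctor : S2 C ⥤ S1 C := (seqIncl C ⋙ ShortComplex.π₃).core

/-- The functor `G : S₂ ⥤ S₁ × S₁` sending `A ⟶ B ⟶ A'` to `(A, A')`. -/
abbrev endsFunctor : S2 C ⥤ S1 C × S1 C := (subFunctor C).prod' (quotFunctor C)

/-- The functor `G' : S₂ ⥤ S₁ × S₁` sending `A ⟶ B ⟶ A'` to `(A', A)`. -/
abbrev endsFunctor' : S2 C ⥤ S1 C × S1 C := (quotFunctor C).prod' (subFunctor C)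

variable {C}

lemma finite_coreHom {D : Type u₁} [Category.{v₁} D] (X Y : Core D)
    [Finite (X.of ⟶ Y.of)] : Finite (X ⟶ Y) :=
  Finite.of_injective (fun f : X ⟶ Y => f.iso.hom) fun _ _ h => Core.hom_ext h

section
variable (C) [IsFinitary C]

lemma finite_hom_S1 (X Y : S1 C) : Finite (X ⟶ Y) :=
  have := IsFinitary.finite_hom X.of Y.of
  finite_coreHom X Y

lemma finite_hom_S2 (X Y : S2 C) : Finite (X ⟶ Y) := by
  have h1 := IsFinitary.finite_hom X.of.obj.X₁ Y.of.obj.X₁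
  have h2 := IsFinitary.finite_hom X.of.obj.X₂ Y.of.obj.X₂
  have h3 := IsFinitary.finite_hom X.of.obj.X₃ Y.of.obj.X₃
  have : Finite (X.of ⟶ Y.of) := by
    refine Finite.of_injective (fun f : X.of ⟶ Y.of =>
      ((((seqIncl C).map f).τ₁, ((seqIncl C).map f).τ₂, ((seqIncl C).map f).τ₃) :
        (X.of.obj.X₁ ⟶ Y.of.obj.X₁) × (X.of.obj.X₂ ⟶ Y.of.obj.X₂) ×
          (X.of.obj.X₃ ⟶ Y.of.obj.X₃))) ?_
    intro f g h
    simp only [Prod.mk.injEq] at h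
    exact (seqIncl C).map_injective (ShortComplex.hom_ext _ _ h.1 h.2.1 h.2.2)
  exact finite_coreHom X Y

lemma finite_hom_S1_prod (X Y : S1 C × S1 C) : Finite (X ⟶ Y) := by
  have h1 := finite_hom_S1 C X.1 Y.1
  have h2 := finite_hom_S1 C X.2 Y.2
  exact Finite.of_injective (fun f : X ⟶ Y => ((f.1, f.2) : (X.1 ⟶ Y.1) × (X.2 ⟶ Y.2)))
    fun f g h => Prod.ext (congrArg Prod.fst h) (congrArg Prod.snd h)

lemma midFunctor_locallyFinite : LocallyFinite (midFunctor C) :=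
  locallyFinite_of_finite_hom _ (fun X => finite_hom_S2 C X X) (finite_hom_S1 C)

lemma endsFunctor'_locallyFinite : LocallyFinite (endsFunctor' C) :=
  locallyFinite_of_finite_hom _ (fun X => finite_hom_S2 C X X) (finite_hom_S1_prod C)

end

/-- An isomorphism of short exact sequences, as an isomorphism in `S₂`. -/
def S2.isoMk {X Y : S2 C} (e : X.of.obj ≅ Y.of.obj) : X ≅ Y :=
  Core.isoMk ((ObjectProperty.fullyFaithfulι _).preimageIso e)

lemma endsFunctor_pi0Finite [IsFinitary C] : Pi0Finite (endsFunctor C) := by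
  intro c
  induction c using Quotient.inductionOn with | _ b
  obtain ⟨⟨A⟩, ⟨A'⟩⟩ := b
  have := IsFinitary.finite_ext A' A
  let toS2 : Extension C A' A → S2 C := fun E => ⟨⟨ShortComplex.mk E.i E.p E.zero, E.shortExact⟩⟩
  let f : ExtensionClasses C A' A → Pi0 (S2 C) :=
    Quotient.map' (s₁ := extensionSetoid C A' A) toS2 (by
      rintro E E' ⟨e, h1, h2⟩
      exact ⟨S2.isoMk (ShortComplex.isoMk (Iso.refl _) e (Iso.refl _)
        (by simp [toS2, h1]) (by simp [toS2, h2]))⟩)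
  refine (Set.finite_range f).subset ?_
  intro x hx
  induction x using Quotient.inductionOn with | _ S
  obtain ⟨i⟩ := Pi0.mk_eq_iff.1 hx
  let i₁ : S.of.obj.X₁ ≅ A := (Core.inclusion C).mapIso ((CategoryTheory.Prod.fst _ _).mapIso i)
  let i₃ : S.of.obj.X₃ ≅ A' := (Core.inclusion C).mapIso ((CategoryTheory.Prod.snd _ _).mapIso i)
  have hz : (i₁.inv ≫ S.of.obj.f) ≫ (S.of.obj.g ≫ i₃.hom) = 0 := by simp
  let e : S.of.obj ≅ ShortComplex.mk (i₁.inv ≫ S.of.obj.f) (S.of.obj.g ≫ i₃.hom) hz :=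
    ShortComplex.isoMk i₁ (Iso.refl _) i₃ (by simp) (by simp)
  let E : Extension C A' A :=
    { X := S.of.obj.X₂
      i := i₁.inv ≫ S.of.obj.f
      p := S.of.obj.g ≫ i₃.hom
      zero := hz
      shortExact := ShortComplex.shortExact_of_iso e S.of.property }
  exact ⟨Quotient.mk _ E, Pi0.mk_eq_iff.2 ⟨S2.isoMk (X := toS2 E) (Y := S) e.symm⟩⟩

lemma midFunctor_pi0Finite [IsCofinitary C] : Pi0Finite (midFunctor C) := by
  intro c
  induction c using Quotient.inductionOn with | _ b
  obtain ⟨B⟩ := b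
  have := IsCofinitary.finite_subobject B
  let f : Subobject B → Pi0 (S2 C) := fun K =>
    Pi0.mk ⟨⟨ShortComplex.mk K.arrow (cokernel.π K.arrow) (cokernel.condition _),
      ShortComplex.ShortExact.mk' (ShortComplex.exact_cokernel _) inferInstance inferInstance⟩⟩
  refine (Set.finite_range f).subset ?_
  intro x hx
  induction x using Quotient.inductionOn with | _ S
  obtain ⟨i⟩ := Pi0.mk_eq_iff.1 hx
  let i₂ : S.of.obj.X₂ ≅ B := (Core.inclusion C).mapIso i
  have hS := S.of.property
  have := hS.mono_f
  have := hS.epi_g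
  let K : Subobject B := Subobject.mk (S.of.obj.f ≫ i₂.hom)
  refine ⟨K, Pi0.mk_eq_iff.2 ⟨S2.isoMk ?_⟩⟩
  let j : (K : C) ≅ S.of.obj.X₁ := Subobject.underlyingIso (S.of.obj.f ≫ i₂.hom)
  have hj : j.hom ≫ S.of.obj.f = K.arrow ≫ i₂.inv := by
    rw [Iso.eq_comp_inv, Category.assoc]
    exact Subobject.underlyingIso_hom_comp_eq_mk _
  let k : cokernel K.arrow ≅ S.of.obj.X₃ :=
    cokernel.mapIso K.arrow S.of.obj.f j i₂.symm hj.symm ≪≫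
      IsColimit.coconePointUniqueUpToIso (cokernelIsCokernel _) hS.gIsCokernel
  refine ShortComplex.isoMk j i₂.symm k hj ?_
  have h1 : cokernel.π S.of.obj.f ≫ (IsColimit.coconePointUniqueUpToIso
      (cokernelIsCokernel S.of.obj.f) hS.gIsCokernel).hom = S.of.obj.g :=
    IsColimit.comp_coconePointUniqueUpToIso_hom (cokernelIsCokernel S.of.obj.f) hS.gIsCokernel
      WalkingParallelPair.one
  simp [k, h1]

variable (C)

/-- The factor `|Ext¹(A', B)| / |Hom(A', B)|`. -/
def twist [HasExt.{w} C] (A' B : C) : ℚ :=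
  (Nat.card (Ext.{w} A' B 1) : ℚ) / (Nat.card (A' ⟶ B) : ℚ)

lemma twist_congr [HasExt.{w} C] {A A' B B' : C} (e : A ≅ A') (e' : B ≅ B') :
    twist.{w} C A B = twist.{w} C A' B' := by
  have h1 : Nat.card (Ext.{w} A B 1) = Nat.card (Ext.{w} A' B' 1) :=
    Nat.card_congr ((((extFunctor.{w} (C := C) 1).mapIso e.symm.op).app B ≪≫
      ((extFunctor.{w} (C := C) 1).obj (Opposite.op A')).mapIso e').addCommGroupIsoToAddEquiv.toEquiv)
  have h2 : Nat.card (A ⟶ B) = Nat.card (A' ⟶ B') := Nat.card_congr (e.homCongr e')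
  simp only [twist, h1, h2]

variable [IsFinitary C]

/-- The underlying vector space `H = 𝓕(S₁)` of the Hall algebra. -/
abbrev Hall : Submodule ℚ (S1 C → ℚ) := GFun (S1 C)

/-- The multiplication `μ : H ⊗ H ⟶ H` given by the span `S₁ × S₁ ⟵ S₂ ⟶ S₁` with legs `G`
and `F`. -/
def mul : Hall C ⊗[ℚ] Hall C →ₗ[ℚ] Hall C :=
  spanMap (endsFunctor C) (midFunctor C) endsFunctor_pi0Finite (midFunctor_locallyFinite C) ∘ₗ
    (tensorEquiv (S1 C) (S1 C)).toLinearMap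

/-- The comultiplication `Δ' : H ⟶ H ⊗ H` given by the span `S₁ ⟵ S₂ ⟶ S₁ × S₁` with legs `F`
and `G'`. -/
def comul [IsCofinitary C] : Hall C →ₗ[ℚ] Hall C ⊗[ℚ] Hall C :=
  (tensorEquiv (S1 C) (S1 C)).symm.toLinearMap ∘ₗ
    spanMap (midFunctor C) (endsFunctor' C) midFunctor_pi0Finite (endsFunctor'_locallyFinite C)

/-- The twisted multiplication `μᵗ` on `H ⊗ H`: the linear map with
`(𝟙_A ⊗ 𝟙_B) ⊗ (𝟙_A' ⊗ 𝟙_B') ↦ |Ext¹(A', B)| / |Hom(A', B)| • (𝟙_A 𝟙_A') ⊗ (𝟙_B 𝟙_B')`,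
defined on the basis of indicator functions (see `twistedMul_indicator`). -/
def twistedMul [HasExt.{w} C] :
    (Hall C ⊗[ℚ] Hall C) ⊗[ℚ] (Hall C ⊗[ℚ] Hall C) →ₗ[ℚ] Hall C ⊗[ℚ] Hall C :=
  let b := indicatorBasis (S1 C)
  ((b.tensorProduct b).tensorProduct (b.tensorProduct b)).constr ℚ fun x =>
    twist.{w} C x.2.1.out.of x.1.2.out.of •
      (mul C (b x.1.1 ⊗ₜ[ℚ] b x.2.1) ⊗ₜ[ℚ] mul C (b x.1.2 ⊗ₜ[ℚ] b x.2.2))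

lemma twistedMul_indicator [HasExt.{w} C] (A B A' B' : S1 C) :
    twistedMul.{w} C ((indicator A ⊗ₜ[ℚ] indicator B) ⊗ₜ[ℚ] (indicator A' ⊗ₜ[ℚ] indicator B')) =
      ((Nat.card (Ext.{w} A'.of B.of 1) : ℚ) / (Nat.card (A'.of ⟶ B.of) : ℚ)) •
        (mul C (indicator A ⊗ₜ[ℚ] indicator A') ⊗ₜ[ℚ] mul C (indicator B ⊗ₜ[ℚ] indicator B')) := by
  have h := Module.Basis.constr_basis (((indicatorBasis (S1 C)).tensorProduct
    (indicatorBasis (S1 C))).tensorProduct ((indicatorBasis (S1 C)).tensorProduct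
    (indicatorBasis (S1 C)))) ℚ (fun x => twist.{w} C x.2.1.out.of x.1.2.out.of •
      (mul C (indicatorBasis (S1 C) x.1.1 ⊗ₜ[ℚ] indicatorBasis (S1 C) x.2.1) ⊗ₜ[ℚ]
        mul C (indicatorBasis (S1 C) x.1.2 ⊗ₜ[ℚ] indicatorBasis (S1 C) x.2.2)))
    ((Pi0.mk A, Pi0.mk B), (Pi0.mk A', Pi0.mk B'))
  simp only [Module.Basis.tensorProduct_apply, indicatorBasis_mk] at h
  have h2 : twist.{w} C (Pi0.mk A').out.of (Pi0.mk B).out.of = twist.{w} C A'.of B.of :=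
    twist_congr C ((Core.inclusion C).mapIso (Pi0.out_iso A').some)
      ((Core.inclusion C).mapIso (Pi0.out_iso B).some)
  rw [h2] at h
  exact h

end HallAlgebra

end

end HallGreen

/-!
Both sides are evaluated on `φ ⊗ ψ` and compared at a pair of objects `(x, y)`. The 2-fiber of `F`
at `B` is equivalent to the set of subobjects of `B`, and the 2-fiber of `G'` at `(x, y)` is the
groupoid of extensions of `x` by `y`, whose automorphism groups are all isomorphic to `Hom(x, y)`.
So the product is a sum over subobjects (`mul_apply`), the coproduct is a sum over the classes of
extensions divided by `|Hom(x, y)|` (`comul_apply`), and the twisted product is a sum over pairs of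
subobjects (`twistedMul_apply`). The claim becomes Green's formula `finsum_subobject`: on one side
stands a sum over the extensions `E` of `x` by `y` and the subobjects `S` of `E`, on the other a sum
over the subobjects `x₁ ≤ x`, `y₁ ≤ y`, the extensions `K` of `x₁` by `y₁` and the extensions `L` of
`x / x₁` by `y / y₁`.

A subobject `S` of `E` induces the subobjects `x₁ = im(S ⟶ x)` and `y₁ = S ∩ y`. It is then an
extension of `x₁` by `y₁`, and `E / S` is one of `x / x₁` by `y / y₁`, so that everything fits in a
three-by-three diagram. For fixed `x₁` and `y₁` this reduces Green's formula to counting `Grid`s: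
the completions of given rows `K`, `L` and given outer columns `y₁ ⟶ y ⟶ y / y₁`,
`x₁ ⟶ x ⟶ x / x₁` by a middle row `E` and a middle column (`card_subobject_identifications`,
`finsum_induces`).

The number of grids is computed in `card_grid`. Write `X`, `Y` for the outer columns, with
`X` an extension of `a'` by `a` and `Y` one of `b'` by `b`. The middle term of a grid maps onto the
fibre product `P = L ×_{a'} X` with kernel `b`, and this extension of `P` by `b` restricts to `Y` on
`b' ⊆ P` and to `K` on `a ⊆ P`; conversely such an extension and its restrictions determine
the grid (`gridEquiv`, `card_grid_mul`). As `P` is an extension of `a'` by `a ⊕ b'`, and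
`Ext²(a', b) = 0`, the map `Ext¹(P, b) ⟶ Ext¹(a ⊕ b', b)` is surjective, and the size of its fibres
is given by the long exact sequence of `Hom(-, b)` (`card_ext_restrict`, `card_restriction`). The
twist `|Ext¹(a', b)| / |Hom(a', b)|` comes from there.
-/

universe w'

namespace HallGreen

noncomputable section

/-! ### Yoneda extensions represent all of `Ext¹` -/

section Surj
open DerivedCategory Pretriangulated
variable {C : Type u} [Category.{v} C] [Abelian C]

/-- The middle term of a distinguished triangle with outer terms in the heart is in the heart. -/
lemma isGE_isLE_of_triangle [HasDerivedCategory.{w'} C] {Y X : C} {M : DerivedCategory C}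
    {f : (singleFunctor C 0).obj Y ⟶ M} {g : M ⟶ (singleFunctor C 0).obj X}
    {h : (singleFunctor C 0).obj X ⟶ ((singleFunctor C 0).obj Y)⟦(1 : ℤ)⟧}
    (hT : Triangle.mk f g h ∈ distTriang (DerivedCategory C)) : M.IsGE 0 ∧ M.IsLE 0 := by
  have key : ∀ i : ℤ, i ≠ 0 → IsZero ((homologyFunctor C i).obj M) := fun i hi => by
    refine (HomologySequence.exact₂ _ hT i).isZero_X₂ ?_ ?_
    · refine IsZero.eq_of_src ?_ _ _
      rcases lt_or_gt_of_ne hi with hi | hi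
      · exact isZero_of_isGE ((singleFunctor C 0).obj Y) 0 i hi
      · exact isZero_of_isLE ((singleFunctor C 0).obj Y) 0 i hi
    · refine IsZero.eq_of_tgt ?_ _ _
      rcases lt_or_gt_of_ne hi with hi | hi
      · exact isZero_of_isGE ((singleFunctor C 0).obj X) 0 i hi
      · exact isZero_of_isLE ((singleFunctor C 0).obj X) 0 i hi
  exact ⟨(isGE_iff _ _).2 fun i hi => key i hi.ne, (isLE_iff _ _).2 fun i hi => key i hi.ne'⟩

/-- Distinguished triangles in the heart come from short exact sequences. -/
lemma shortExact_of_triangle [HasDerivedCategory.{w'} C] {S : ShortComplex C}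
    {h : (singleFunctor C 0).obj S.X₃ ⟶ ((singleFunctor C 0).obj S.X₁)⟦(1 : ℤ)⟧}
    (hT : Triangle.mk ((singleFunctor C 0).map S.f) ((singleFunctor C 0).map S.g) h ∈
      distTriang (DerivedCategory C)) : S.ShortExact := by
  have e := singleFunctorCompHomologyFunctorIso C 0
  let S' : ShortComplex C := S.map (singleFunctor C 0 ⋙ homologyFunctor C 0)
  have i : S' ≅ S := S.mapNatIso e
  refine ShortComplex.shortExact_of_iso i ?_
  have h1 : S'.Exact := HomologySequence.exact₂ _ hT 0
  have h2 : Mono S'.f := (HomologySequence.mono_homologyMap_mor₁_iff _ hT (-1) 0).2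
    (IsZero.eq_of_src (isZero_of_isGE ((singleFunctor C 0).obj S.X₃) 0 (-1) (by decide)) _ _)
  have h3 : Epi S'.g := (HomologySequence.epi_homologyMap_mor₂_iff _ hT 0 1).2
    (IsZero.eq_of_tgt (isZero_of_isLE ((singleFunctor C 0).obj S.X₁) 0 1 (by decide)) _ _)
  exact ShortComplex.ShortExact.mk' h1 h2 h3

variable [HasExt.{w} C]

/-- Every class in `Ext¹` is the class of an extension: its middle term is the cocone of the
corresponding morphism in the derived category, which lies in the heart. -/
lemma exists_extClass_eq {X Y : C} (α : Ext.{w} X Y 1) :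
    ∃ E : Extension C X Y, E.shortExact.extClass = α := by
  let := HasDerivedCategory.standard C
  obtain ⟨a, ha⟩ : ∃ a : (singleFunctor C 0).obj X ⟶ ((singleFunctor C 0).obj Y)⟦(1 : ℤ)⟧,
      α.hom = a := ⟨_, rfl⟩
  obtain ⟨M, f, g, hT⟩ := distinguished_cocone_triangle₂ a
  obtain ⟨h1, h2⟩ := isGE_isLE_of_triangle hT
  obtain ⟨M₀, ⟨e⟩⟩ := exists_iso_singleFunctor_obj_of_isGE_of_isLE M 0
  obtain ⟨i, hi⟩ := (singleFunctor C 0).map_surjective (f ≫ e.hom)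
  obtain ⟨p, hp⟩ := (singleFunctor C 0).map_surjective (e.inv ≫ g)
  have hT' : Triangle.mk ((singleFunctor C 0).map i) ((singleFunctor C 0).map p)
      a ∈ distTriang (DerivedCategory C) := by
    refine isomorphic_distinguished _ hT _
      (Triangle.isoMk _ _ (Iso.refl _) e.symm (Iso.refl _) ?_ ?_ ?_)
    · change (singleFunctor C 0).map i ≫ e.inv = 𝟙 _ ≫ f
      rw [hi, Category.assoc, e.hom_inv_id, Category.comp_id, Category.id_comp]
    · change (singleFunctor C 0).map p ≫ 𝟙 _ = e.inv ≫ g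
      rw [hp, Category.comp_id]
    · change a ≫ (𝟙 ((singleFunctor C 0).obj Y))⟦(1 : ℤ)⟧' = 𝟙 _ ≫ a
      rw [CategoryTheory.Functor.map_id, Category.comp_id, Category.id_comp]
  have hz : i ≫ p = 0 := (singleFunctor C 0).map_injective (by
    rw [Functor.map_comp, Functor.map_zero]
    exact comp_distTriang_mor_zero₁₂ _ hT')
  have hS : (ShortComplex.mk i p hz).ShortExact := shortExact_of_triangle hT'
  refine ⟨⟨M₀, i, p, hz, hS⟩, ?_⟩
  -- compare with the standard triangle of the short exact sequence; the comparison map `c` on the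
  -- third terms is the identity as `p` is an epimorphism
  obtain ⟨c, hc1, hc2⟩ := complete_distinguished_triangle_morphism _ _ hT'
    hS.singleTriangle_distinguished (𝟙 ((singleFunctor C 0).obj Y)) (𝟙 ((singleFunctor C 0).obj M₀))
      ((Category.comp_id _).trans (Category.id_comp _).symm)
  have : Epi p := hS.epi_g
  obtain ⟨c, rfl⟩ := (singleFunctor C 0).map_surjective c
  have hc : c = 𝟙 X := by
    rw [← cancel_epi p]
    refine (singleFunctor C 0).map_injective ?_
    rw [Functor.map_comp, Category.comp_id]
    exact hc1.trans (Category.id_comp _)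
  ext
  rw [ShortComplex.ShortExact.extClass_hom, ha]
  have h3 : a ≫ (𝟙 ((singleFunctor C 0).obj Y))⟦(1 : ℤ)⟧' =
    (singleFunctor C 0).map c ≫ hS.singleδ := hc2
  rw [hc, CategoryTheory.Functor.map_id, CategoryTheory.Functor.map_id, Category.comp_id,
    Category.id_comp] at h3
  exact h3.symm

end Surj

/-! ### Equivalence classes of extensions -/

section ExtClasses

variable {C : Type u} [Category.{v} C] [Abelian C]

/-- The morphisms of extensions `E' ⟶ E` which are the identity on the common subobject `B` and
`f` on the quotients. -/
@[ext]
structure ExtHom {A A' B : C} (f : A' ⟶ A) (E' : Extension C A' B) (E : Extension C A B) where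
  hom : E'.X ⟶ E.X
  i_hom : E'.i ≫ hom = E.i
  hom_p : hom ≫ E.p = E'.p ≫ f

attribute [simp] ExtHom.i_hom ExtHom.hom_p

@[simp]
lemma ExtHom.i_hom_assoc {A A' B W : C} {f : A' ⟶ A} {E' : Extension C A' B}
    {E : Extension C A B} (k : ExtHom f E' E) (h : E.X ⟶ W) : E'.i ≫ k.hom ≫ h = E.i ≫ h := by
  rw [← Category.assoc, k.i_hom]

@[simp]
lemma ExtHom.hom_p_assoc {A A' B W : C} {f : A' ⟶ A} {E' : Extension C A' B}
    {E : Extension C A B} (k : ExtHom f E' E) (h : A ⟶ W) :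
    k.hom ≫ E.p ≫ h = E'.p ≫ f ≫ h := by
  rw [← Category.assoc, k.hom_p, Category.assoc]

instance {A B : C} (E : Extension C A B) : Mono E.i := E.shortExact.mono_f
instance {A B : C} (E : Extension C A B) : Epi E.p := E.shortExact.epi_g

attribute [simp] Extension.zero

@[simp]
lemma Extension.zero_assoc {A B W : C} (E : Extension C A B) (k : A ⟶ W) :
    E.i ≫ E.p ≫ k = 0 := by
  rw [← Category.assoc, E.zero, zero_comp]

lemma Extension.exists_lift {A B W : C} (E : Extension C A B) (k : W ⟶ E.X) (hk : k ≫ E.p = 0) :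
    ∃ l : W ⟶ B, l ≫ E.i = k :=
  have : Mono (ShortComplex.mk E.i E.p E.zero).f := E.shortExact.mono_f
  ⟨E.shortExact.exact.lift k hk, E.shortExact.exact.lift_f k hk⟩

lemma Extension.exists_desc {A B W : C} (E : Extension C A B) (k : E.X ⟶ W) (hk : E.i ≫ k = 0) :
    ∃ l : A ⟶ W, E.p ≫ l = k :=
  have : Epi (ShortComplex.mk E.i E.p E.zero).g := E.shortExact.epi_g
  ⟨E.shortExact.exact.desc k hk, E.shortExact.exact.g_desc k hk⟩

lemma ExtHom.isIso {A A' B : C} {f : A' ⟶ A} [IsIso f] {E' : Extension C A' B}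
    {E : Extension C A B} (k : ExtHom f E' E) : IsIso k.hom :=
  ShortComplex.isIso₂_of_shortExact_of_isIso₁₃'
    (S₁ := ShortComplex.mk E'.i E'.p E'.zero) (S₂ := ShortComplex.mk E.i E.p E.zero)
    { τ₁ := 𝟙 B, τ₂ := k.hom, τ₃ := f, comm₁₂ := by simp [k.i_hom], comm₂₃ := k.hom_p }
    E'.shortExact E.shortExact inferInstance inferInstance

/-- Morphisms of extensions over a given morphism of quotients form a torsor under `Hom(A', B)`. -/
def ExtHom.equivHom {A A' B : C} {f : A' ⟶ A} {E' : Extension C A' B} {E : Extension C A B}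
    (k₀ : ExtHom f E' E) : (A' ⟶ B) ≃ ExtHom f E' E :=
  Equiv.ofBijective
    (fun g => ⟨k₀.hom + E'.p ≫ g ≫ E.i, by simp [k₀.i_hom], by simp [k₀.hom_p]⟩) <| by
    constructor
    · intro g g' h
      have h' := congrArg ExtHom.hom h
      simpa [cancel_epi, cancel_mono] using h'
    · intro k
      obtain ⟨d, hd⟩ := E'.exists_desc (k.hom - k₀.hom) (by simp [k.i_hom, k₀.i_hom])
      obtain ⟨g, hg⟩ := E.exists_lift d (by
        rw [← cancel_epi E'.p, reassoc_of% hd]; simp [k.hom_p, k₀.hom_p])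
      exact ⟨g, ExtHom.ext (by simp [hg, hd])⟩

/-- The class of an extension. -/
def ExtensionClasses.mk {A B : C} (E : Extension C A B) : ExtensionClasses C A B :=
  Quotient.mk (extensionSetoid C A B) E

/-- A representative of a class of extensions. -/
def ExtensionClasses.out {A B : C} (c : ExtensionClasses C A B) : Extension C A B :=
  Quotient.out c

@[simp]
lemma ExtensionClasses.mk_out {A B : C} (c : ExtensionClasses C A B) : mk c.out = c :=
  Quotient.out_eq c

lemma ExtensionClasses.mk_eq_mk_iff {A B : C} {E E' : Extension C A B} :
    mk E = mk E' ↔ Nonempty (ExtHom (𝟙 A) E E') := by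
  refine Quotient.eq.trans ⟨fun ⟨e, h1, h2⟩ => ⟨⟨e.hom, h1, by simpa using h2⟩⟩, fun ⟨k⟩ => ?_⟩
  have := k.isIso
  exact ⟨asIso k.hom, k.i_hom, by simp⟩

/-- Each extension has exactly `|Hom(A, B)|` isomorphisms to a chosen representative of its
class. -/
lemma card_extHom_out {A B : C} (E : Extension C A B) :
    Nat.card (Σ c : ExtensionClasses C A B, ExtHom (𝟙 A) E c.out) = Nat.card (A ⟶ B) := by
  let c₀ := ExtensionClasses.mk E
  obtain ⟨k₀⟩ := ExtensionClasses.mk_eq_mk_iff.1 c₀.mk_out.symm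
  refine (Nat.card_congr ((ExtHom.equivHom k₀).trans
    (Equiv.ofBijective (fun k => ⟨c₀, k⟩) ⟨fun k k' h => ?_, ?_⟩))).symm
  · simpa using h
  · rintro ⟨c, k⟩
    obtain rfl : c₀ = c := by
      rw [← c.mk_out]
      exact ExtensionClasses.mk_eq_mk_iff.2 ⟨k⟩
    exact ⟨k, rfl⟩

instance [IsFinitary C] (A B : C) : Finite (A ⟶ B) := IsFinitary.finite_hom A B
instance [IsFinitary C] (A B : C) : Finite (ExtensionClasses C A B) := IsFinitary.finite_ext A B
instance [IsFinitary C] {A A' B : C} (f : A' ⟶ A) (E' : Extension C A' B) (E : Extension C A B) :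
    Finite (ExtHom f E' E) :=
  Finite.of_injective ExtHom.hom fun _ _ => ExtHom.ext

variable [HasExt.{w} C]

/-- The class in `Ext¹` of an extension. -/
abbrev Extension.cls {A B : C} (E : Extension C A B) : Ext.{w} A B 1 := E.shortExact.extClass

/-- A morphism of extensions over `f` exists exactly when the class of the source is the pullback
along `f` of the class of the target. -/
lemma nonempty_extHom_iff {A A' B : C} (f : A' ⟶ A) (E' : Extension C A' B)
    (E : Extension C A B) :
    Nonempty (ExtHom f E' E) ↔ (Ext.mk₀ f).comp E.cls.{w} (zero_add 1) = E'.cls := by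
  constructor
  · rintro ⟨k⟩
    have := ShortComplex.ShortExact.extClass_naturality.{w} E'.shortExact E.shortExact
      { τ₁ := 𝟙 B, τ₂ := k.hom, τ₃ := f, comm₁₂ := by simp [k.i_hom], comm₂₃ := k.hom_p }
    simpa using this.symm
  · intro h
    -- lift `E'.p ≫ f` to the middle terms, then correct the induced endomorphism `c` of `B`
    obtain ⟨x, hx⟩ := Ext.covariant_sequence_exact₃.{w} E'.X E.shortExact
      (Ext.mk₀ (E'.p ≫ f)) (zero_add 1) (by
        rw [← Ext.mk₀_comp_mk₀_assoc, h]
        exact E'.shortExact.comp_extClass)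
    obtain ⟨k, rfl⟩ := (Ext.mk₀_bijective _ _).2 x
    have hk : k ≫ E.p = E'.p ≫ f := (Ext.mk₀_bijective _ _).1 (by simpa using hx)
    obtain ⟨c, hc⟩ := E.exists_lift (E'.i ≫ k) (by simp [hk])
    have h1 : E'.cls.{w}.comp (Ext.mk₀ c) (add_zero 1) = E'.cls := by
      have := ShortComplex.ShortExact.extClass_naturality.{w} E'.shortExact E.shortExact
        { τ₁ := c, τ₂ := k, τ₃ := f, comm₁₂ := hc, comm₂₃ := hk }
      exact this.trans h
    obtain ⟨y, hy⟩ := Ext.contravariant_sequence_exact₁.{w} E'.shortExact B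
      (Ext.mk₀ (𝟙 B - c)) (add_zero 1) (by
        rw [sub_eq_add_neg, Ext.mk₀_add, Ext.mk₀_neg, Ext.comp_add, Ext.comp_neg, h1]
        simp)
    obtain ⟨d, rfl⟩ := (Ext.mk₀_bijective _ _).2 y
    have hd : E'.i ≫ d = 𝟙 B - c := (Ext.mk₀_bijective _ _).1 (by simpa using hy)
    exact ⟨⟨k + d ≫ E.i, by simp [reassoc_of% hd, hc], by simp [hk]⟩⟩

/-- Equivalence classes of extensions are the elements of `Ext¹`. -/
def extClassEquiv (A B : C) : ExtensionClasses C A B ≃ Ext.{w} A B 1 :=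
  Equiv.ofBijective (fun c => c.out.cls) <| by
    constructor
    · intro c c' h
      rw [← c.mk_out, ← c'.mk_out]
      exact ExtensionClasses.mk_eq_mk_iff.2
        ((nonempty_extHom_iff.{w} _ _ _).2 (by simpa using h.symm))
    · intro α
      obtain ⟨E, rfl⟩ := exists_extClass_eq α
      refine ⟨.mk E, ?_⟩
      have h := ExtensionClasses.mk_eq_mk_iff.1 (ExtensionClasses.mk E).mk_out.symm
      simpa using (nonempty_extHom_iff.{w} _ _ _).1 h

lemma finite_ext_one [IsFinitary C] (A B : C) : Finite (Ext.{w} A B 1) :=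
  Finite.of_equiv _ (extClassEquiv A B)

open Classical in
lemma card_extHom {A A' B : C} (f : A' ⟶ A) (E' : Extension C A' B) (E : Extension C A B) :
    Nat.card (ExtHom f E' E) =
      if (Ext.mk₀ f).comp E.cls.{w} (zero_add 1) = E'.cls then Nat.card (A' ⟶ B) else 0 := by
  split_ifs with h
  · obtain ⟨k⟩ := (nonempty_extHom_iff f E' E).2 h
    exact (Nat.card_congr (ExtHom.equivHom k)).symm
  · have : IsEmpty (ExtHom f E' E) := not_nonempty_iff.1 (mt (nonempty_extHom_iff f E' E).1 h)
    exact Nat.card_of_isEmpty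

end ExtClasses

/-! ### Extensions of extensions and fibre products -/

section Diagrams

variable {C : Type u} [Category.{v} C] [Abelian C]

lemma shortExact_of_refinements {A B X : C} {i : B ⟶ X} {p : X ⟶ A} (zero : i ≫ p = 0)
    (hi : Mono i) (hp : Epi p) (h : ∀ ⦃W : C⦄ (k : W ⟶ X), k ≫ p = 0 →
      ∃ (W' : C) (π : W' ⟶ W) (_ : Epi π) (l : W' ⟶ B), π ≫ k = l ≫ i) :
    (ShortComplex.mk i p zero).ShortExact :=
  .mk' ((ShortComplex.exact_iff_exact_up_to_refinements _).2 fun _ k hk => h k hk) hi hp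

/-- Given a subobject `b'` of `R.X` with quotient `x`, and an extension `m` of `R.X` by `b` which
restricts over `b'` to the extension `Y`, the middle term of `m` is an extension of `x` by `Y.X`. -/
abbrev Extension.comp {b b' x : C} {Y : Extension C b' b} {R : Extension C x b'}
    {m : Extension C R.X b} (h : ExtHom R.i Y m) : Extension C x Y.X where
  X := m.X
  i := h.hom
  p := m.p ≫ R.p
  zero := by rw [← Category.assoc, h.hom_p]; simp
  shortExact := by
    refine shortExact_of_refinements _ ?_ (epi_comp _ _) fun W k hk => ?_
    · refine Preadditive.mono_of_cancel_zero _ fun w hw => ?_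
      have h1 : w ≫ Y.p = 0 := by
        rw [← cancel_mono R.i, Category.assoc, ← h.hom_p, reassoc_of% hw]; simp
      obtain ⟨w, rfl⟩ := Y.exists_lift w h1
      rw [Category.assoc, h.i_hom] at hw
      rw [(cancel_mono m.i).1 (hw.trans zero_comp.symm), zero_comp]
    · obtain ⟨c, hc⟩ := R.exists_lift (k ≫ m.p) (by simpa using hk)
      obtain ⟨W', π, hπ, d, hd⟩ := surjective_up_to_refinements_of_epi Y.p c
      obtain ⟨e, he⟩ := m.exists_lift (π ≫ k - d ≫ h.hom) (by
        simp [h.hom_p, ← hc, reassoc_of% hd])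
      exact ⟨W', π, hπ, d + e ≫ Y.i, by simp [h.i_hom, he]⟩

/-- If `y` is an extension of `b'` by `b`, an extension `E` of `x` by `y` with a morphism `t` to an
extension `R` of `x` by `b'` is an extension of `R.X` by `b`. -/
abbrev Extension.uncomp {b b' x : C} {Y : Extension C b' b} {R : Extension C x b'}
    {E : Extension C x Y.X} (t : E.X ⟶ R.X) (h1 : E.i ≫ t = Y.p ≫ R.i) (h2 : t ≫ R.p = E.p) :
    Extension C R.X b where
  X := E.X
  i := Y.i ≫ E.i
  p := t
  zero := by simp [h1]
  shortExact := by
    refine shortExact_of_refinements _ (mono_comp _ _) ?_ fun W k hk => ?_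
    · refine Preadditive.epi_of_cancel_zero _ fun w hw => ?_
      have h3 : R.i ≫ w = 0 := by
        rw [← cancel_epi Y.p, ← Category.assoc, ← h1, Category.assoc, hw]; simp
      obtain ⟨w, rfl⟩ := R.exists_desc w h3
      rw [← Category.assoc, h2] at hw
      rw [(cancel_epi E.p).1 (hw.trans comp_zero.symm), comp_zero]
    · obtain ⟨c, hc⟩ := E.exists_lift k (by rw [← h2, reassoc_of% hk, zero_comp])
      obtain ⟨d, hd⟩ := Y.exists_lift c (by
        rw [← cancel_mono R.i, Category.assoc, ← h1, reassoc_of% hc, hk, zero_comp])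
      exact ⟨W, 𝟙 W, inferInstance, d, by simp [reassoc_of% hd, hc]⟩

variable {a a' b' : C} (L : Extension C a' b') (X : Extension C a' a)

/-- The inclusion `b' ⟶ L.X ×_{a'} X.X`. -/
def inclLeft : b' ⟶ Limits.pullback L.p X.p := Limits.pullback.lift L.i 0 (by simp)

/-- The inclusion `a ⟶ L.X ×_{a'} X.X`. -/
def inclRight : a ⟶ Limits.pullback L.p X.p := Limits.pullback.lift 0 X.i (by simp)

@[simp] lemma inclLeft_fst : inclLeft L X ≫ Limits.pullback.fst _ _ = L.i :=
  Limits.pullback.lift_fst _ _ _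

@[simp] lemma inclLeft_snd : inclLeft L X ≫ Limits.pullback.snd _ _ = 0 :=
  Limits.pullback.lift_snd _ _ _

@[simp] lemma inclRight_fst : inclRight L X ≫ Limits.pullback.fst _ _ = 0 :=
  Limits.pullback.lift_fst _ _ _

@[simp] lemma inclRight_snd : inclRight L X ≫ Limits.pullback.snd _ _ = X.i :=
  Limits.pullback.lift_snd _ _ _

instance : Mono (inclLeft L X) := mono_of_mono_fac (inclLeft_fst L X)
instance : Mono (inclRight L X) := mono_of_mono_fac (inclRight_snd L X)

/-- The fibre product over `a'` of two extensions, as an extension of the second middle term. -/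
abbrev pullbackSnd : Extension C X.X b' where
  X := Limits.pullback L.p X.p
  i := inclLeft L X
  p := Limits.pullback.snd _ _
  zero := by simp
  shortExact := by
    refine shortExact_of_refinements _ inferInstance inferInstance fun W k hk => ?_
    · obtain ⟨l, hl⟩ := L.exists_lift (k ≫ Limits.pullback.fst _ _) (by
        rw [Category.assoc, Limits.pullback.condition, reassoc_of% hk, zero_comp])
      exact ⟨W, 𝟙 W, inferInstance, l, by ext <;> simp [hl, hk]⟩

/-- The fibre product over `a'` of two extensions, as an extension of the first middle term. -/
abbrev pullbackFst : Extension C L.X a where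
  X := Limits.pullback L.p X.p
  i := inclRight L X
  p := Limits.pullback.fst _ _
  zero := by simp
  shortExact := by
    refine shortExact_of_refinements _ inferInstance inferInstance fun W k hk => ?_
    · obtain ⟨l, hl⟩ := X.exists_lift (k ≫ Limits.pullback.snd _ _) (by
        rw [Category.assoc, ← Limits.pullback.condition, reassoc_of% hk, zero_comp])
      exact ⟨W, 𝟙 W, inferInstance, l, by ext <;> simp [hl, hk]⟩

/-- The fibre product over `a'` of two extensions, as an extension of `a'` by `a ⊞ b'`. -/
abbrev pullbackBiprod : Extension C a' (a ⊞ b') where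
  X := Limits.pullback L.p X.p
  i := biprod.desc (inclRight L X) (inclLeft L X)
  p := Limits.pullback.fst _ _ ≫ L.p
  zero := by
    ext <;> simp [reassoc_of% inclRight_fst L X, reassoc_of% inclLeft_fst L X]
  shortExact := by
    refine shortExact_of_refinements _ ?_ (epi_comp _ _) fun W k hk => ?_
    · refine Preadditive.mono_of_cancel_zero _ fun w hw => ?_
      have h1 := hw =≫ Limits.pullback.fst _ _
      have h2 := hw =≫ Limits.pullback.snd _ _
      ext
      · rw [← cancel_mono X.i]
        simpa [biprod.desc_eq] using h2
      · rw [← cancel_mono L.i]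
        simpa [biprod.desc_eq] using h1
    · obtain ⟨c, hc⟩ := L.exists_lift (k ≫ Limits.pullback.fst _ _) (by simpa using hk)
      obtain ⟨d, hd⟩ := (pullbackFst L X).exists_lift (k - c ≫ inclLeft L X) (by
        simp [hc])
      refine ⟨W, 𝟙 W, inferInstance, biprod.lift d c, ?_⟩
      rw [biprod.lift_desc, hd]
      simp

end Diagrams

/-! ### Three-by-three diagrams -/

section Grids

variable {C : Type u} [Category.{v} C] [Abelian C]
variable {a a' b b' : C} (Y : Extension C b' b) (X : Extension C a' a) (K : Extension C a b)
  (L : Extension C a' b')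

/-- A completion of the three-by-three diagram
```
b  ⟶  K  ⟶  a
↓     ↓     ↓
Y  ⟶  E  ⟶  X
↓     ↓     ↓
b' ⟶  L  ⟶  a'
```
with given rows and given outer columns by a middle column. -/
structure Grid (E : Extension C X.X Y.X) where
  k : K.X ⟶ E.X
  l : E.X ⟶ L.X
  i_k : K.i ≫ k = Y.i ≫ E.i
  k_p : k ≫ E.p = K.p ≫ X.i
  i_l : E.i ≫ l = Y.p ≫ L.i
  l_p : l ≫ L.p = E.p ≫ X.p
  k_l : k ≫ l = 0

/-- The restrictions of an extension `m` of `L ×_{a'} X` by `b` to `Y` and to `K`. -/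
abbrev Restriction (m : Extension C (Limits.pullback L.p X.p) b) : Type v :=
  ExtHom (inclLeft L X) Y m × ExtHom (inclRight L X) K m

variable {Y X K L}

/-- The middle term of a grid as an extension of `L ×_{a'} X` by `b`. -/
abbrev Grid.toPullback {E : Extension C X.X Y.X} (g : Grid Y X K L E) :
    Extension C (Limits.pullback L.p X.p) b :=
  Extension.uncomp (R := pullbackSnd L X) (Limits.pullback.lift g.l E.p g.l_p)
    (by ext <;> simp [g.i_l, Limits.pullback.lift_fst, Limits.pullback.lift_snd])
    (Limits.pullback.lift_snd _ _ _)

/-- An extension of `L ×_{a'} X` by `b` which restricts to `Y` is an extension of `X` by `Y`. -/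
abbrev Restriction.toExt {m : Extension C (Limits.pullback L.p X.p) b}
    (h : Restriction Y X K L m) : Extension C X.X Y.X :=
  Extension.comp (R := pullbackSnd L X) (m := m) h.1

lemma Grid.sigma_ext {E : Extension C X.X Y.X} {m : Extension C (Limits.pullback L.p X.p) b}
    {x y : Σ g : Grid Y X K L E, ExtHom (𝟙 _) g.toPullback m} (hk : x.1.k = y.1.k)
    (hl : x.1.l = y.1.l) (h : x.2.hom = y.2.hom) : x = y := by
  obtain ⟨⟨k, l, _, _, _, _, _⟩, ⟨θ, _, _⟩⟩ := x
  obtain ⟨⟨k', l', _, _, _, _, _⟩, ⟨θ', _, _⟩⟩ := y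
  obtain rfl : k = k' := hk
  obtain rfl : l = l' := hl
  obtain rfl : θ = θ' := h
  rfl

lemma Restriction.sigma_ext {E : Extension C X.X Y.X}
    {m : Extension C (Limits.pullback L.p X.p) b}
    {x y : Σ h : Restriction Y X K L m, ExtHom (𝟙 _) h.toExt E} (h1 : x.1.1.hom = y.1.1.hom)
    (h2 : x.1.2.hom = y.1.2.hom) (h : x.2.hom = y.2.hom) : x = y := by
  obtain ⟨⟨⟨k, _, _⟩, ⟨l, _, _⟩⟩, ⟨θ, _, _⟩⟩ := x
  obtain ⟨⟨⟨k', _, _⟩, ⟨l', _, _⟩⟩, ⟨θ', _, _⟩⟩ := y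
  obtain rfl : k = k' := h1
  obtain rfl : l = l' := h2
  obtain rfl : θ = θ' := h
  rfl

/-- Transport of a grid on `E` along a morphism from `E` to an extension of `L ×_{a'} X`. -/
@[simps]
def Grid.restrict {E : Extension C X.X Y.X} {m : Extension C (Limits.pullback L.p X.p) b}
    (g : Grid Y X K L E) (θ : E.X ⟶ m.X) (h₁ : Y.i ≫ E.i ≫ θ = m.i)
    (h₂ : θ ≫ m.p = Limits.pullback.lift g.l E.p g.l_p) : Restriction Y X K L m :=
  (⟨E.i ≫ θ, h₁, by
      rw [Category.assoc, h₂]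
      ext <;> simp [g.i_l, Limits.pullback.lift_fst, Limits.pullback.lift_snd]⟩,
    ⟨g.k ≫ θ, by rw [← h₁, ← Category.assoc, g.i_k, Category.assoc], by
      rw [Category.assoc, h₂]
      ext <;> simp [g.k_l, g.k_p, Limits.pullback.lift_fst, Limits.pullback.lift_snd]⟩)

/-- Transport of the restrictions of an extension of `L ×_{a'} X` along an isomorphism from its
middle term to that of `E`. -/
@[simps]
def Restriction.grid {E : Extension C X.X Y.X} {m : Extension C (Limits.pullback L.p X.p) b}
    (h : Restriction Y X K L m) (η : m.X ⟶ E.X) [IsIso η] (h₁ : h.1.hom ≫ η = E.i)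
    (h₂ : η ≫ E.p = m.p ≫ Limits.pullback.snd _ _) : Grid Y X K L E where
  k := h.2.hom ≫ η
  l := inv η ≫ m.p ≫ Limits.pullback.fst _ _
  i_k := by rw [h.2.i_hom_assoc, ← h₁, h.1.i_hom_assoc]
  k_p := by simp [h₂]
  i_l := by simp [← h₁]
  l_p := by
    rw [← cancel_epi η, reassoc_of% h₂]
    simp [Limits.pullback.condition]
  k_l := by simp

/-- Isomorphisms between the middle terms of `E` and `m` transport grids on `E` to restrictions
of `m` and back. -/
def gridEquiv (E : Extension C X.X Y.X) (m : Extension C (Limits.pullback L.p X.p) b) :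
    (Σ g : Grid Y X K L E, ExtHom (𝟙 _) g.toPullback m) ≃
      (Σ h : Restriction Y X K L m, ExtHom (𝟙 _) h.toExt E) where
  toFun x :=
    have := x.2.isIso
    have h₂ : x.2.hom ≫ m.p = Limits.pullback.lift x.1.l E.p x.1.l_p :=
      x.2.hom_p.trans (Category.comp_id _)
    ⟨x.1.restrict x.2.hom ((Category.assoc _ _ _).symm.trans x.2.i_hom) h₂,
      ⟨inv x.2.hom, by simp, by
        rw [IsIso.inv_comp_eq, Category.comp_id]
        simp [reassoc_of% h₂, Limits.pullback.lift_snd]⟩⟩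
  invFun y :=
    have := y.2.isIso
    ⟨y.1.grid y.2.hom y.2.i_hom (by simp),
      ⟨inv y.2.hom, by
        rw [IsIso.comp_inv_eq]
        have h₁ : y.1.1.hom ≫ y.2.hom = E.i := y.2.i_hom
        simp [← h₁], by
        refine Eq.trans ?_ (Category.comp_id _).symm
        have h₂ : y.2.hom ≫ E.p = m.p ≫ Limits.pullback.snd _ _ :=
          y.2.hom_p.trans (Category.comp_id _)
        refine Limits.pullback.hom_ext (by simp [Limits.pullback.lift_fst]) ?_
        exact (Category.assoc _ _ _).trans
          (((IsIso.inv_comp_eq _).2 h₂.symm).trans (Limits.pullback.lift_snd _ _ _).symm)⟩⟩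
  left_inv x := by
    have := x.2.isIso
    have h₂ : x.2.hom ≫ m.p = Limits.pullback.lift x.1.l E.p x.1.l_p :=
      x.2.hom_p.trans (Category.comp_id _)
    refine Grid.sigma_ext ?_ ?_ ?_ <;> simp [reassoc_of% h₂, Limits.pullback.lift_fst]
  right_inv y := by
    have := y.2.isIso
    have h₁ : y.1.1.hom ≫ y.2.hom = E.i := y.2.i_hom
    refine Restriction.sigma_ext ?_ ?_ ?_
    · change E.i ≫ inv y.2.hom = y.1.1.hom
      rw [← h₁, Category.assoc, IsIso.hom_inv_id, Category.comp_id]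
    · simp
    · simp

/-- The middle column of a grid is exact. -/
lemma Grid.shortExact {E : Extension C X.X Y.X} (g : Grid Y X K L E) :
    (ShortComplex.mk g.k g.l g.k_l).ShortExact := by
  let h : ExtHom (pullbackFst L X).i K g.toPullback := ⟨g.k, g.i_k, by
    change g.k ≫ Limits.pullback.lift g.l E.p g.l_p = K.p ≫ inclRight L X
    ext <;> simp [g.k_l, g.k_p, Limits.pullback.lift_fst, Limits.pullback.lift_snd]⟩
  refine ShortComplex.shortExact_of_iso ?_ (Extension.comp h).shortExact
  exact ShortComplex.isoMk (Iso.refl _) (Iso.refl _) (Iso.refl _)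
    ((Category.id_comp _).trans (Category.comp_id _).symm)
    ((Category.id_comp _).trans ((Limits.pullback.lift_fst (f := L.p) (g := X.p) g.l E.p
      g.l_p).symm.trans (Category.comp_id _).symm))

variable (Y X K L)

lemma card_sigma_const {ι : Type*} {β : ι → Type*} [Finite ι] [∀ i, Finite (β i)] {n : ℕ}
    (h : ∀ i, Nat.card (β i) = n) : Nat.card (Σ i, β i) = Nat.card ι * n := by
  have := Fintype.ofFinite ι
  simp [Nat.card_sigma, h]

instance [IsFinitary C] (E : Extension C X.X Y.X) : Finite (Grid Y X K L E) :=
  Finite.of_injective (fun g => (g.k, g.l)) fun g g' h => by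
    cases g; cases g'; simp_all

/-- The two ways of reading the middle term `M` of a grid, as an extension of `X` by `Y` and as an
extension of `L ×_{a'} X` by `b`, give the same count of grids, weighted by the automorphisms of
these extensions. Both sides count the isomorphisms from a chosen extension of the first kind to a
chosen extension of the second kind. -/
lemma card_grid_mul [IsFinitary C] :
    Nat.card (Σ c : ExtensionClasses C X.X Y.X, Grid Y X K L c.out) *
        Nat.card (Limits.pullback L.p X.p ⟶ b) =
      Nat.card (Σ c : ExtensionClasses C (Limits.pullback L.p X.p) b,
        Restriction Y X K L c.out) * Nat.card (X.X ⟶ Y.X) := by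
  rw [← card_sigma_const (β := fun z : Σ c : ExtensionClasses C X.X Y.X, Grid Y X K L c.out =>
      Σ d : ExtensionClasses C (Limits.pullback L.p X.p) b, ExtHom (𝟙 _) z.2.toPullback d.out)
      fun z => card_extHom_out _,
    ← card_sigma_const (β := fun z : Σ c : ExtensionClasses C (Limits.pullback L.p X.p) b,
        Restriction Y X K L c.out =>
      Σ d : ExtensionClasses C X.X Y.X, ExtHom (𝟙 _) z.2.toExt d.out)
      fun z => card_extHom_out _]
  refine Nat.card_congr ⟨fun x =>
      let y := gridEquiv x.1.1.out x.2.1.out ⟨x.1.2, x.2.2⟩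
      ⟨⟨x.2.1, y.1⟩, ⟨x.1.1, y.2⟩⟩,
    fun y =>
      let x := (gridEquiv y.2.1.out y.1.1.out).symm ⟨y.1.2, y.2.2⟩
      ⟨⟨y.2.1, x.1⟩, ⟨y.1.1, x.2⟩⟩, ?_, ?_⟩
  · rintro ⟨⟨c, g⟩, ⟨d, θ⟩⟩
    have h := (gridEquiv c.out d.out).symm_apply_apply ⟨g, θ⟩
    exact congrArg (fun z : Σ g : Grid Y X K L c.out, ExtHom (𝟙 _) g.toPullback d.out =>
      (⟨⟨c, z.1⟩, ⟨d, z.2⟩⟩ : Σ z : Σ c : ExtensionClasses C X.X Y.X, Grid Y X K L c.out,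
        Σ d : ExtensionClasses C (Limits.pullback L.p X.p) b,
          ExtHom (𝟙 _) z.2.toPullback d.out)) h
  · rintro ⟨⟨d, g⟩, ⟨c, θ⟩⟩
    have h := (gridEquiv c.out d.out).apply_symm_apply ⟨g, θ⟩
    exact congrArg (fun z : Σ h : Restriction Y X K L d.out, ExtHom (𝟙 _) h.toExt c.out =>
      (⟨⟨d, z.1⟩, ⟨c, z.2⟩⟩ : Σ z : Σ c : ExtensionClasses C (Limits.pullback L.p X.p) b,
          Restriction Y X K L c.out,
        Σ d : ExtensionClasses C X.X Y.X, ExtHom (𝟙 _) z.2.toExt d.out)) h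

end Grids

/-! ### The number of three-by-three diagrams -/

section Counting

lemma card_eq_card_ker_mul_card_range {A B : Type*} [AddCommGroup A] [AddCommGroup B]
    (f : A →+ B) :
    Nat.card A = Nat.card f.ker * Nat.card f.range := by
  rw [← Nat.card_congr (QuotientAddGroup.quotientKerEquivRange f).toEquiv, mul_comm]
  exact f.ker.card_eq_card_quotient_mul_card_addSubgroup

/-- Multiplicativity of orders along a six-term exact sequence of abelian groups, in which the
last map is only measured through the size of its fibres. -/
lemma card_fiber_mul_of_exact {A B C D E F : Type*} [AddCommGroup A] [AddCommGroup B]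
    [AddCommGroup C] [AddCommGroup D] [AddCommGroup E] [AddCommGroup F]
    {i : A →+ B} {f : B →+ C} {δ : C →+ D} {g : D →+ E} {h : E →+ F} (hi : Function.Injective i)
    (hif : Function.Exact i f) (hfδ : Function.Exact f δ) (hδg : Function.Exact δ g)
    (hgh : Function.Exact g h) {y : F} (hy : ∃ e, h e = y) :
    Nat.card {e // h e = y} * (Nat.card C * Nat.card A) = Nat.card D * Nat.card B := by
  obtain ⟨e₀, rfl⟩ := hy
  have h0 : Nat.card {e // h e = h e₀} = Nat.card h.ker :=
    Nat.card_congr ((Equiv.subRight e₀).subtypeEquiv fun e => by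
      simp [AddMonoidHom.mem_ker, sub_eq_zero])
  have h1 : Nat.card i.range = Nat.card A :=
    (Nat.card_congr (AddMonoidHom.ofInjective hi).toEquiv).symm
  rw [h0, card_eq_card_ker_mul_card_range f, card_eq_card_ker_mul_card_range δ,
    card_eq_card_ker_mul_card_range g, hif.addMonoidHom_ker_eq, hfδ.addMonoidHom_ker_eq,
    hδg.addMonoidHom_ker_eq, hgh.addMonoidHom_ker_eq, h1]
  ring

variable {C : Type u} [Category.{v} C] [Abelian C]

lemma card_hom_biprod (a b' b : C) :
    Nat.card (a ⊞ b' ⟶ b) = Nat.card (a ⟶ b) * Nat.card (b' ⟶ b) := by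
  rw [← Nat.card_prod]
  exact Nat.card_congr
    { toFun := fun f => (biprod.inl ≫ f, biprod.inr ≫ f)
      invFun := fun f => biprod.desc f.1 f.2
      left_inv := fun f => by ext <;> simp
      right_inv := fun f => by simp }

variable [HasExt.{w} C]

lemma card_ext_zero (A B : C) : Nat.card (Ext.{w} A B 0) = Nat.card (A ⟶ B) :=
  Nat.card_congr Ext.homEquiv₀

/-- For an extension `S` of `A` by `D`, the number of classes in `Ext¹(S.X, B)` restricting to a
given class in `Ext¹(D, B)`, when `Ext²(A, B) = 0`. -/
lemma card_ext_restrict [IsHereditary.{w} C] {A D B : C} (S : Extension C A D)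
    (ε : Ext.{w} D B 1) :
    Nat.card {e : Ext.{w} S.X B 1 // (Ext.mk₀ S.i).comp e (zero_add 1) = ε} *
        (Nat.card (D ⟶ B) * Nat.card (A ⟶ B)) =
      Nat.card (Ext.{w} A B 1) * Nat.card (S.X ⟶ B) := by
  have hS := S.shortExact
  have e2 (n : ℕ) := (ShortComplex.ab_exact_iff_function_exact _).1
    (Ext.contravariant_sequence_exact₂'.{w} hS B n)
  have e1 := (ShortComplex.ab_exact_iff_function_exact _).1
    (Ext.contravariant_sequence_exact₁'.{w} hS B 0 1 (by lia))
  have e3 := (ShortComplex.ab_exact_iff_function_exact _).1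
    (Ext.contravariant_sequence_exact₃'.{w} hS B 0 1 (by lia))
  have := IsHereditary.subsingleton_ext.{w} A B 2 (by lia)
  have key := card_fiber_mul_of_exact (h := (Ext.mk₀ S.i).precomp B (zero_add 1))
    (Ext.precomp_mk₀_injective_of_epi.{w} B S.p) (e2 0) e1 e3 (e2 1) (y := ε)
    (Ext.contravariant_sequence_exact₁.{w} hS B ε (n₁ := 2) (by lia) (Subsingleton.elim _ _))
  simp only [card_ext_zero] at key
  exact key

variable {a a' b b' : C} (Y : Extension C b' b) (X : Extension C a' a) (K : Extension C a b)
  (L : Extension C a' b')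

open Classical in
/-- The classes in `Ext¹` of the fibre product `L ×_{a'} X` with prescribed restrictions to `b'` and
`a` form a fibre of the restriction to `Ext¹(a ⊞ b', b)`. -/
lemma card_restriction [IsFinitary C] [IsHereditary.{w} C] :
    Nat.card (Σ c : ExtensionClasses C (Limits.pullback L.p X.p) b, Restriction Y X K L c.out) *
        Nat.card (a' ⟶ b) =
      Nat.card (Ext.{w} a' b 1) * Nat.card (Limits.pullback L.p X.p ⟶ b) := by
  let ε : Ext.{w} (a ⊞ b') b 1 := Ext.biprodAddEquiv.symm (K.cls, Y.cls)
  have hε (e : Ext.{w} (Limits.pullback L.p X.p) b 1) :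
      (Ext.mk₀ (pullbackBiprod L X).i).comp e (zero_add 1) = ε ↔
        (Ext.mk₀ (inclLeft L X)).comp e (zero_add 1) = Y.cls ∧
          (Ext.mk₀ (inclRight L X)).comp e (zero_add 1) = K.cls := by
    rw [AddEquiv.eq_symm_apply, Prod.ext_iff, and_comm]
    simp
  have h1 : Nat.card (Σ c : ExtensionClasses C (Limits.pullback L.p X.p) b,
      Restriction Y X K L c.out) =
        Nat.card {e : Ext.{w} (Limits.pullback L.p X.p) b 1 //
          (Ext.mk₀ (pullbackBiprod L X).i).comp e (zero_add 1) = ε} *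
          (Nat.card (a ⊞ b' ⟶ b)) := by
    have := Fintype.ofFinite (ExtensionClasses C (Limits.pullback L.p X.p) b)
    have := finite_ext_one.{w} (Limits.pullback L.p X.p) b
    have := Fintype.ofFinite (Ext.{w} (Limits.pullback L.p X.p) b 1)
    have h2 (c : ExtensionClasses C (Limits.pullback L.p X.p) b) :
        Nat.card (Restriction Y X K L c.out) =
          if (Ext.mk₀ (pullbackBiprod L X).i).comp (extClassEquiv.{w} _ _ c) (zero_add 1) = ε
            then Nat.card (a ⊞ b' ⟶ b) else 0 := by
      rw [Nat.card_prod, card_extHom.{w}, card_extHom.{w}, card_hom_biprod, if_congr (hε _) rfl rfl]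
      change (if _ then _ else _) * (if _ then _ else _) =
        if (Ext.mk₀ (inclLeft L X)).comp c.out.cls.{w} (zero_add 1) = Y.cls ∧
          (Ext.mk₀ (inclRight L X)).comp c.out.cls.{w} (zero_add 1) = K.cls then _ else _
      split_ifs <;> simp_all [mul_comm]
    rw [Nat.card_sigma, Finset.sum_congr rfl fun c _ => h2 c,
      Equiv.sum_comp (extClassEquiv.{w} (Limits.pullback L.p X.p) b) fun e =>
        if (Ext.mk₀ (pullbackBiprod L X).i).comp e (zero_add 1) = ε
          then Nat.card (a ⊞ b' ⟶ b) else 0,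
      ← Finset.sum_filter, Finset.sum_const, smul_eq_mul]
    congr 1
    rw [Nat.card_eq_fintype_card, Fintype.card_subtype]
  rw [h1, mul_assoc]
  exact card_ext_restrict (pullbackBiprod L X) ε

/-- The number of ways to complete a three-by-three diagram. -/
lemma card_grid [IsFinitary C] [IsHereditary.{w} C] :
    Nat.card (Σ c : ExtensionClasses C X.X Y.X, Grid Y X K L c.out) * Nat.card (a' ⟶ b) =
      Nat.card (Ext.{w} a' b 1) * Nat.card (X.X ⟶ Y.X) := by
  have h1 := card_grid_mul Y X K L
  have h2 := card_restriction.{w} Y X K L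
  have h3 : 0 < Nat.card (Limits.pullback L.p X.p ⟶ b) := Nat.card_pos
  refine Nat.eq_of_mul_eq_mul_right h3 ?_
  calc _ = _ * Nat.card (Limits.pullback L.p X.p ⟶ b) * Nat.card (a' ⟶ b) := by ring
    _ = _ := by rw [h1]
    _ = _ * Nat.card (a' ⟶ b) * Nat.card (X.X ⟶ Y.X) := by ring
    _ = _ := by rw [h2]
    _ = _ := by ring

end Counting

/-! ### Subobjects of the middle term of an extension -/

section Subobjects

variable {C : Type u} [Category.{v} C] [Abelian C]

lemma imageSubobject_eq_of_epi {A B : C} {P : Subobject B} {f : A ⟶ B} (e : A ⟶ (P : C)) [Epi e]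
    (h : e ≫ P.arrow = f) : imageSubobject f = P := by
  subst h
  have : IsIso (Subobject.ofLE _ _ (imageSubobject_comp_le e P.arrow)) :=
    isIso_of_mono_of_epi _
  have h1 : imageSubobject (e ≫ P.arrow) = imageSubobject P.arrow :=
    le_antisymm (imageSubobject_comp_le e P.arrow) (Subobject.le_of_comm
      (inv (Subobject.ofLE _ _ (imageSubobject_comp_le e P.arrow))) (by simp))
  rw [h1, imageSubobject_mono, Subobject.mk_arrow]

/-- A subobject of `x` as an extension of the quotient by it. -/
abbrev subobjectExt {x : C} (S : Subobject x) : Extension C (cokernel S.arrow) (S : C) where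
  X := x
  i := S.arrow
  p := cokernel.π S.arrow
  zero := cokernel.condition _
  shortExact := .mk' (ShortComplex.exact_cokernel _) inferInstance inferInstance

variable {x y : C} (E : Extension C x y)

/-- The subobject `S` of the middle term of an extension of `x` by `y` induces the subobjects `x₁`
and `y₁`: the intersection of `S` with `y` is `y₁` and its image in `x` is `x₁`. -/
structure Induces (S : Subobject E.X) (x₁ : Subobject x) (y₁ : Subobject y) : Prop where
  pullback_eq : (Subobject.pullback E.i).obj S = y₁
  image_eq : imageSubobject (S.arrow ≫ E.p) = x₁

variable {E} {x₁ : Subobject x} {y₁ : Subobject y}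

lemma Induces.factors_sub {S : Subobject E.X} (h : Induces E S x₁ y₁) :
    S.Factors (y₁.arrow ≫ E.i) := by
  obtain ⟨rfl, -⟩ := h
  rw [← (Subobject.isPullback E.i S).w]
  exact Subobject.factors_comp_arrow _

lemma Induces.factors_quot {S : Subobject E.X} (h : Induces E S x₁ y₁) :
    x₁.Factors (S.arrow ≫ E.p) := by
  obtain ⟨-, rfl⟩ := h
  have h := imageSubobject_factors_comp_self (f := S.arrow ≫ E.p) (𝟙 _)
  rwa [Category.id_comp] at h

/-- The extension of `x₁` by `y₁` given by a subobject which induces them. -/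
abbrev Induces.sub {S : Subobject E.X} (h : Induces E S x₁ y₁) :
    Extension C (x₁ : C) (y₁ : C) where
  X := S
  i := S.factorThru _ h.factors_sub
  p := x₁.factorThru _ h.factors_quot
  zero := by
    rw [← cancel_mono x₁.arrow]
    simp
  shortExact := by
    refine shortExact_of_refinements _ ?_ ?_ fun W k hk => ?_
    · exact mono_of_mono_fac (S.factorThru_arrow _ h.factors_sub)
    · have hq := h.factors_quot
      obtain ⟨-, rfl⟩ := h
      have : (imageSubobject (S.arrow ≫ E.p)).factorThru (S.arrow ≫ E.p) hq =
          factorThruImageSubobject (S.arrow ≫ E.p) := by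
        rw [← cancel_mono (imageSubobject (S.arrow ≫ E.p)).arrow]
        simp
      rw [this]
      infer_instance
    · have hk' : (k ≫ S.arrow) ≫ E.p = 0 := by
        have := hk =≫ x₁.arrow
        simpa using this
      obtain ⟨l, hl⟩ := E.exists_lift _ hk'
      obtain ⟨rfl, -⟩ := h
      refine ⟨W, 𝟙 W, inferInstance, (Subobject.isPullback E.i S).lift k l hl.symm, ?_⟩
      rw [← cancel_mono S.arrow, Category.assoc, Category.assoc, S.factorThru_arrow,
        IsPullback.lift_snd_assoc, hl, Category.id_comp]

/-- The second isomorphism theorem in the form of the three-by-three lemma. -/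
lemma Induces.exists_quot {S : Subobject E.X} (h : Induces E S x₁ y₁) :
    ∃ (i : cokernel y₁.arrow ⟶ cokernel S.arrow) (p : cokernel S.arrow ⟶ cokernel x₁.arrow)
      (zero : i ≫ p = 0), E.i ≫ cokernel.π S.arrow = cokernel.π y₁.arrow ≫ i ∧
        cokernel.π S.arrow ≫ p = E.p ≫ cokernel.π x₁.arrow ∧
        (ShortComplex.mk i p zero).ShortExact := by
  have hi : h.sub.i ≫ S.arrow = y₁.arrow ≫ E.i := S.factorThru_arrow _ h.factors_sub
  have hp : h.sub.p ≫ x₁.arrow = S.arrow ≫ E.p := x₁.factorThru_arrow _ h.factors_quot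
  let i : cokernel y₁.arrow ⟶ cokernel S.arrow := cokernel.desc _ (E.i ≫ cokernel.π S.arrow) (by
    rw [← Category.assoc, ← hi, Category.assoc, cokernel.condition, comp_zero])
  let p : cokernel S.arrow ⟶ cokernel x₁.arrow := cokernel.desc _ (E.p ≫ cokernel.π x₁.arrow) (by
    rw [← Category.assoc, ← hp, Category.assoc, cokernel.condition, comp_zero])
  have hi' : cokernel.π y₁.arrow ≫ i = E.i ≫ cokernel.π S.arrow := cokernel.π_desc _ _ _
  have hp' : cokernel.π S.arrow ≫ p = E.p ≫ cokernel.π x₁.arrow := cokernel.π_desc _ _ _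
  refine ⟨i, p, ?_, hi'.symm, hp', shortExact_of_refinements _ ?_ ?_ fun W k hk => ?_⟩
  · rw [← cancel_epi (cokernel.π y₁.arrow), reassoc_of% hi', hp']
    simp
  · refine Preadditive.mono_of_cancel_zero _ fun {W} w hw => ?_
    obtain ⟨W', π, hπ, w', hw'⟩ := surjective_up_to_refinements_of_epi (cokernel.π y₁.arrow) w
    obtain ⟨s, hs⟩ := (subobjectExt S).exists_lift (w' ≫ E.i) (by
      change (w' ≫ E.i) ≫ cokernel.π S.arrow = 0
      rw [Category.assoc, ← hi', ← reassoc_of% hw', hw, comp_zero])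
    change s ≫ S.arrow = w' ≫ E.i at hs
    obtain ⟨t, ht⟩ := h.sub.exists_lift s (by
      rw [← cancel_mono x₁.arrow, Category.assoc, hp, reassoc_of% hs]
      simp)
    have h1 : t ≫ y₁.arrow = w' := by
      rw [← cancel_mono E.i, Category.assoc, ← hi, reassoc_of% ht, hs]
    rw [← cancel_epi π, hw', ← h1]
    simp
  · exact epi_of_epi_fac hp'
  · obtain ⟨W₁, π₁, hπ₁, m, hm⟩ := surjective_up_to_refinements_of_epi (cokernel.π S.arrow) k
    obtain ⟨c, hc⟩ := (subobjectExt x₁).exists_lift (m ≫ E.p) (by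
      change (m ≫ E.p) ≫ cokernel.π x₁.arrow = 0
      rw [Category.assoc, ← hp', ← reassoc_of% hm, hk, comp_zero])
    change c ≫ x₁.arrow = m ≫ E.p at hc
    have : Epi h.sub.p := h.sub.shortExact.epi_g
    obtain ⟨W₂, π₂, hπ₂, s, hs⟩ := surjective_up_to_refinements_of_epi h.sub.p c
    obtain ⟨t, ht⟩ := E.exists_lift (π₂ ≫ m - s ≫ S.arrow) (by
      rw [Preadditive.sub_comp, Category.assoc, Category.assoc, ← hp, ← reassoc_of% hs, hc,
        sub_self])
    refine ⟨W₂, π₂ ≫ π₁, epi_comp _ _, t ≫ cokernel.π y₁.arrow, ?_⟩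
    rw [Category.assoc, Category.assoc, hm, hi', reassoc_of% ht]
    simp

/-- The extension of `x / x₁` by `y / y₁` given by a subobject which induces `x₁` and `y₁`. -/
abbrev Induces.quot {S : Subobject E.X} (h : Induces E S x₁ y₁) :
    Extension C (cokernel x₁.arrow) (cokernel y₁.arrow) where
  X := cokernel S.arrow
  i := h.exists_quot.choose
  p := h.exists_quot.choose_spec.choose
  zero := h.exists_quot.choose_spec.choose_spec.choose
  shortExact := h.exists_quot.choose_spec.choose_spec.choose_spec.2.2

lemma Induces.i_π {S : Subobject E.X} (h : Induces E S x₁ y₁) :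
    E.i ≫ cokernel.π S.arrow = cokernel.π y₁.arrow ≫ h.quot.i :=
  h.exists_quot.choose_spec.choose_spec.choose_spec.1

lemma Induces.π_p {S : Subobject E.X} (h : Induces E S x₁ y₁) :
    cokernel.π S.arrow ≫ h.quot.p = E.p ≫ cokernel.π x₁.arrow :=
  h.exists_quot.choose_spec.choose_spec.choose_spec.2.1

variable {K : Extension C (x₁ : C) (y₁ : C)}
  {L : Extension C (cokernel x₁.arrow) (cokernel y₁.arrow)}

instance (g : Grid (subobjectExt y₁) (subobjectExt x₁) K L E) : Mono g.k := g.shortExact.mono_f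
instance (g : Grid (subobjectExt y₁) (subobjectExt x₁) K L E) : Epi g.l := g.shortExact.epi_g

/-- The middle column of a grid is a subobject which induces `x₁` and `y₁`. -/
lemma Grid.induces (g : Grid (subobjectExt y₁) (subobjectExt x₁) K L E) :
    Induces E (Subobject.mk g.k) x₁ y₁ where
  pullback_eq := by
    have hg : K.i ≫ g.k = y₁.arrow ≫ E.i := g.i_k
    have hp : g.k ≫ E.p = K.p ≫ x₁.arrow := g.k_p
    have hz (s : PullbackCone g.k E.i) : s.fst ≫ K.p = 0 := by
      have h : s.fst ≫ g.k = s.snd ≫ E.i := s.condition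
      rw [← cancel_mono x₁.arrow, Category.assoc, ← hp, reassoc_of% h]
      simp
    choose l hl using fun s : PullbackCone g.k E.i => K.exists_lift s.fst (hz s)
    have : IsPullback K.i y₁.arrow g.k E.i := ⟨⟨hg⟩, ⟨PullbackCone.IsLimit.mk hg l hl
      (fun s => by
        rw [← cancel_mono E.i, Category.assoc, ← hg, ← Category.assoc, hl]
        exact s.condition)
      (fun s m h1 _ => by rw [← cancel_mono K.i, h1, hl])⟩⟩
    rw [Subobject.pullback_obj_mk this, Subobject.mk_arrow]
  image_eq := by
    have hp : g.k ≫ E.p = K.p ≫ x₁.arrow := g.k_p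
    refine imageSubobject_eq_of_epi ((Subobject.underlyingIso g.k).hom ≫ K.p) ?_
    rw [Category.assoc, ← hp, ← Category.assoc, Subobject.underlyingIso_hom_comp_eq_mk]

end Subobjects

/-! ### Green's formula -/

section Transport

variable {C : Type u} [Category.{v} C] [Abelian C]

instance [IsCofinitary C] (X : C) : Finite (Subobject X) := IsCofinitary.finite_subobject X

section

variable {x y : C} {E : Extension C x y} {x₁ : Subobject x} {y₁ : Subobject y}
  {K : Extension C (x₁ : C) (y₁ : C)} {L : Extension C (cokernel x₁.arrow) (cokernel y₁.arrow)}

/-- A subobject `S` of the middle term of `E` which induces `x₁` and `y₁`, with identifications of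
the resulting extensions with `K` and `L`, gives a grid. -/
@[simps]
def Induces.grid {S : Subobject E.X} (h : Induces E S x₁ y₁) (κ : ExtHom (𝟙 _) h.sub K)
    (μ : ExtHom (𝟙 _) h.quot L) : Grid (subobjectExt y₁) (subobjectExt x₁) K L E :=
  have := κ.isIso
  have hi : h.sub.i ≫ S.arrow = y₁.arrow ≫ E.i := S.factorThru_arrow _ h.factors_sub
  have hp : h.sub.p ≫ x₁.arrow = S.arrow ≫ E.p := x₁.factorThru_arrow _ h.factors_quot
  { k := inv κ.hom ≫ S.arrow
    l := cokernel.π S.arrow ≫ μ.hom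
    i_k := by
      rw [← hi, ← κ.i_hom, Category.assoc, IsIso.hom_inv_id_assoc]
    k_p := by
      have : κ.hom ≫ K.p = h.sub.p := κ.hom_p.trans (Category.comp_id _)
      rw [Category.assoc, ← hp, ← this, Category.assoc, IsIso.inv_hom_id_assoc]
    i_l := by
      rw [← Category.assoc, h.i_π, Category.assoc, μ.i_hom]
    l_p := by
      have : μ.hom ≫ L.p = h.quot.p := μ.hom_p.trans (Category.comp_id _)
      rw [Category.assoc, this, h.π_p]
    k_l := by simp }

/-- A grid is the same as a subobject `S` which induces `x₁` and `y₁`, together with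
identifications of the induced extensions with `K` and `L`. -/
lemma card_subobject_identifications :
    Nat.card (Σ S : {S : Subobject E.X // Induces E S x₁ y₁},
      ExtHom (𝟙 _) S.2.sub K × ExtHom (𝟙 _) S.2.quot L) =
    Nat.card (Grid (subobjectExt y₁) (subobjectExt x₁) K L E) := by
  refine Nat.card_congr (Equiv.ofBijective (fun z => z.1.2.grid z.2.1 z.2.2) ⟨?_, fun g => ?_⟩)
  · rintro ⟨⟨S, h⟩, κ, μ⟩ ⟨⟨S', h'⟩, κ', μ'⟩ hz
    have := κ.isIso
    have := κ'.isIso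
    have hk : inv κ.hom ≫ S.arrow = inv κ'.hom ≫ S'.arrow := congrArg Grid.k hz
    have hl : cokernel.π S.arrow ≫ μ.hom = cokernel.π S'.arrow ≫ μ'.hom := congrArg Grid.l hz
    obtain rfl : S = S' := by
      refine le_antisymm (Subobject.le_of_comm (κ.hom ≫ inv κ'.hom) ?_)
        (Subobject.le_of_comm (κ'.hom ≫ inv κ.hom) ?_)
      · rw [Category.assoc, ← hk, IsIso.hom_inv_id_assoc]
      · rw [Category.assoc, hk, IsIso.hom_inv_id_assoc]
    obtain rfl : κ = κ' := ExtHom.ext (IsIso.inv_eq_inv.1 ((cancel_mono _).1 hk))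
    obtain rfl : μ = μ' := ExtHom.ext ((cancel_epi _).1 hl)
    rfl
  · have h := g.induces
    have hi : h.sub.i ≫ (Subobject.mk g.k).arrow = y₁.arrow ≫ E.i :=
      Subobject.factorThru_arrow _ _ h.factors_sub
    have hp : h.sub.p ≫ x₁.arrow = (Subobject.mk g.k).arrow ≫ E.p :=
      x₁.factorThru_arrow _ h.factors_quot
    have hu : (Subobject.underlyingIso g.k).hom ≫ g.k = (Subobject.mk g.k).arrow :=
      Subobject.underlyingIso_hom_comp_eq_mk _
    have hl : (Subobject.mk g.k).arrow ≫ g.l = 0 := by rw [← hu, Category.assoc, g.k_l, comp_zero]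
    refine ⟨⟨⟨_, h⟩, ⟨(Subobject.underlyingIso g.k).hom, ?_, ?_⟩, ⟨cokernel.desc _ g.l hl, ?_, ?_⟩⟩,
      ?_⟩
    · rw [← cancel_mono g.k, Category.assoc, hu, hi]
      exact g.i_k.symm
    · rw [← cancel_mono x₁.arrow, Category.comp_id, hp, Category.assoc]
      refine (congrArg _ g.k_p.symm).trans ?_
      rw [← Category.assoc, hu]
    · rw [← cancel_epi (cokernel.π y₁.arrow), ← Category.assoc, ← h.i_π, Category.assoc,
        cokernel.π_desc]
      exact g.i_l
    · rw [← cancel_epi (cokernel.π (Subobject.mk g.k).arrow), Category.comp_id, h.π_p,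
        ← Category.assoc, cokernel.π_desc]
      exact g.l_p
    · have h1 : inv (Subobject.underlyingIso g.k).hom ≫ (Subobject.mk g.k).arrow = g.k := by
        rw [IsIso.inv_comp_eq, hu]
      have h2 : cokernel.π (Subobject.mk g.k).arrow ≫ cokernel.desc _ g.l hl = g.l :=
        cokernel.π_desc _ _ _
      obtain ⟨k, l, _, _, _, _, _⟩ := g
      simp only [Induces.grid]
      congr

end

lemma finsum_card_extHom_out [IsFinitary C] {φ : C → ℚ} (hφ : ∀ ⦃A B : C⦄, (A ≅ B) → φ A = φ B)
    {A B : C} (E : Extension C A B) :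
    ∑ᶠ c : ExtensionClasses C A B, φ c.out.X * Nat.card (ExtHom (𝟙 A) E c.out) =
      φ E.X * Nat.card (A ⟶ B) := by
  have := Fintype.ofFinite (ExtensionClasses C A B)
  rw [← card_extHom_out E, finsum_eq_sum_of_fintype, Nat.card_sigma, Nat.cast_sum, Finset.mul_sum]
  refine Finset.sum_congr rfl fun c _ => ?_
  rcases isEmpty_or_nonempty (ExtHom (𝟙 A) E c.out) with h | ⟨⟨k⟩⟩
  · simp
  · have := k.isIso
    rw [hφ (asIso k.hom)]

variable [HasExt.{w} C] [IsFinitary C] [IsCofinitary C] [IsHereditary.{w} C]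

/-- Green's formula for fixed subobjects `x₁` and `y₁` of the ends. -/
lemma finsum_induces {φ ψ : C → ℚ} (hφ : ∀ ⦃A B : C⦄, (A ≅ B) → φ A = φ B)
    (hψ : ∀ ⦃A B : C⦄, (A ≅ B) → ψ A = ψ B) {x y : C} (x₁ : Subobject x) (y₁ : Subobject y) :
    (∑ᶠ c : ExtensionClasses C x y, ∑ᶠ S : {S : Subobject c.out.X // Induces c.out S x₁ y₁},
      φ S.1 * ψ (cokernel S.1.arrow)) / Nat.card (x ⟶ y) =
    twist.{w} C (cokernel x₁.arrow) y₁ *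
      ((∑ᶠ c : ExtensionClasses C (x₁ : C) (y₁ : C), φ c.out.X) / Nat.card ((x₁ : C) ⟶ (y₁ : C))) *
      ((∑ᶠ c : ExtensionClasses C (cokernel x₁.arrow) (cokernel y₁.arrow), ψ c.out.X) /
        Nat.card (cokernel x₁.arrow ⟶ cokernel y₁.arrow)) := by
  have (A B : C) := Fintype.ofFinite (ExtensionClasses C A B)
  have (E : Extension C x y) := Fintype.ofFinite {S : Subobject E.X // Induces E S x₁ y₁}
  have h0 (A B : C) : (Nat.card (A ⟶ B) : ℚ) ≠ 0 := Nat.cast_ne_zero.2 Nat.card_pos.ne'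
  -- replace the values at `S` and its cokernel by sums over identifications with chosen extensions
  have h1 (E : Extension C x y) :
      (∑ S : {S : Subobject E.X // Induces E S x₁ y₁}, φ S.1 * ψ (cokernel S.1.arrow)) *
          (Nat.card ((x₁ : C) ⟶ (y₁ : C)) * Nat.card (cokernel x₁.arrow ⟶ cokernel y₁.arrow)) =
        ∑ c₁ : ExtensionClasses C (x₁ : C) (y₁ : C),
          ∑ c₂ : ExtensionClasses C (cokernel x₁.arrow) (cokernel y₁.arrow),
            φ c₁.out.X * ψ c₂.out.X *
              Nat.card (Grid (subobjectExt y₁) (subobjectExt x₁) c₁.out c₂.out E) := by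
    simp only [← card_subobject_identifications, Nat.card_sigma, Nat.card_prod, Nat.cast_sum,
      Nat.cast_mul, Finset.mul_sum, Finset.sum_mul]
    rw [Finset.sum_congr rfl fun _ _ => Finset.sum_comm, Finset.sum_comm]
    refine Finset.sum_congr rfl fun S _ => ?_
    have hK := finsum_card_extHom_out hφ S.2.sub
    have hL := finsum_card_extHom_out hψ S.2.quot
    rw [finsum_eq_sum_of_fintype] at hK hL
    calc _ = (φ S.1 * Nat.card ((x₁ : C) ⟶ (y₁ : C))) *
        (ψ (cokernel S.1.arrow) * Nat.card (cokernel x₁.arrow ⟶ cokernel y₁.arrow)) := by ring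
      _ = _ := by
        rw [← hK, ← hL, Finset.sum_mul_sum]
        exact Finset.sum_congr rfl fun _ _ => Finset.sum_congr rfl fun _ _ => by ring
  have h2 (K : Extension C (x₁ : C) (y₁ : C))
      (L : Extension C (cokernel x₁.arrow) (cokernel y₁.arrow)) :
      (∑ c : ExtensionClasses C x y,
          (Nat.card (Grid (subobjectExt y₁) (subobjectExt x₁) K L c.out) : ℚ)) *
          Nat.card (cokernel x₁.arrow ⟶ (y₁ : C)) =
        Nat.card (Ext.{w} (cokernel x₁.arrow) (y₁ : C) 1) * Nat.card (x ⟶ y) := by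
    have h := card_grid.{w} (subobjectExt y₁) (subobjectExt x₁) K L
    rw [Nat.card_sigma] at h
    exact_mod_cast h
  simp only [finsum_eq_sum_of_fintype, twist]
  rw [div_mul_div_comm, div_mul_div_comm, div_eq_div_iff (h0 _ _)
    (mul_ne_zero (mul_ne_zero (h0 _ _) (h0 _ _)) (h0 _ _))]
  calc _ = (∑ c : ExtensionClasses C x y,
        (∑ S : {S : Subobject c.out.X // Induces c.out S x₁ y₁},
          φ S.1 * ψ (cokernel S.1.arrow)) *
          (Nat.card ((x₁ : C) ⟶ (y₁ : C)) * Nat.card (cokernel x₁.arrow ⟶ cokernel y₁.arrow))) *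
        Nat.card (cokernel x₁.arrow ⟶ (y₁ : C)) := by
        rw [← Finset.sum_mul]
        ring
    _ = ∑ c₁ : ExtensionClasses C (x₁ : C) (y₁ : C),
          ∑ c₂ : ExtensionClasses C (cokernel x₁.arrow) (cokernel y₁.arrow),
            φ c₁.out.X * ψ c₂.out.X * ((∑ c : ExtensionClasses C x y,
              (Nat.card (Grid (subobjectExt y₁) (subobjectExt x₁) c₁.out c₂.out c.out) : ℚ)) *
              Nat.card (cokernel x₁.arrow ⟶ (y₁ : C))) := by
        simp only [h1]
        rw [Finset.sum_comm, Finset.sum_mul]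
        refine Finset.sum_congr rfl fun _ _ => ?_
        rw [Finset.sum_comm, Finset.sum_mul]
        refine Finset.sum_congr rfl fun _ _ => ?_
        rw [← Finset.mul_sum, mul_assoc]
    _ = _ := by
        simp only [h2]
        simp only [← Finset.sum_mul, ← Finset.mul_sum]
        ring

/-- Green's formula, evaluated at a pair of objects. Every subobject of the middle term of an
extension of `x` by `y` induces exactly one pair of subobjects of `x` and `y`. -/
lemma finsum_subobject {φ ψ : C → ℚ} (hφ : ∀ ⦃A B : C⦄, (A ≅ B) → φ A = φ B)
    (hψ : ∀ ⦃A B : C⦄, (A ≅ B) → ψ A = ψ B) (x y : C) :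
    (∑ᶠ c : ExtensionClasses C x y, ∑ᶠ S : Subobject c.out.X, φ S * ψ (cokernel S.arrow)) /
      Nat.card (x ⟶ y) =
    ∑ᶠ x₁ : Subobject x, ∑ᶠ y₁ : Subobject y, twist.{w} C (cokernel x₁.arrow) y₁ *
      ((∑ᶠ c : ExtensionClasses C (x₁ : C) (y₁ : C), φ c.out.X) / Nat.card ((x₁ : C) ⟶ (y₁ : C))) *
      ((∑ᶠ c : ExtensionClasses C (cokernel x₁.arrow) (cokernel y₁.arrow), ψ c.out.X) /
        Nat.card (cokernel x₁.arrow ⟶ cokernel y₁.arrow)) := by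
  classical
  simp only [← finsum_induces.{w} hφ hψ]
  have (A B : C) := Fintype.ofFinite (ExtensionClasses C A B)
  have (A : C) := Fintype.ofFinite (Subobject A)
  simp only [finsum_eq_sum_of_fintype, ← Finset.sum_div]
  congr 1
  rw [Finset.sum_congr rfl fun _ _ => Finset.sum_comm, Finset.sum_comm]
  refine Finset.sum_congr rfl fun c _ => ?_
  rw [← Finset.sum_fiberwise Finset.univ fun S : Subobject c.out.X =>
    imageSubobject (S.arrow ≫ c.out.p)]
  refine Finset.sum_congr rfl fun x₁ _ => ?_
  rw [← Finset.sum_fiberwise _ fun S : Subobject c.out.X => (Subobject.pullback c.out.i).obj S]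
  refine Finset.sum_congr rfl fun y₁ _ => ?_
  rw [Finset.filter_filter]
  refine Finset.sum_subtype _ (fun S => ?_) _
  simp only [Finset.mem_filter, Finset.mem_univ, true_and]
  exact ⟨fun h => ⟨h.2, h.1⟩, fun h => ⟨h.2, h.1⟩⟩

end Transport

/-! ### The structure maps of the Hall algebra -/

section Evaluation

/-- A groupoid integral can be computed with any system of representatives of the isomorphism
classes. -/
lemma integral_eq_finsum {A : Type u₁} [Category.{v₁} A] {φ : A → ℚ}
    (hφ : ∀ a a' : A, Nonempty (a ≅ a') → φ a = φ a') {ι : Type u₂} (X : ι → A)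
    (hX : Function.Bijective fun i => Pi0.mk (X i)) :
    integral φ = ∑ᶠ i, φ (X i) / (Nat.card (Aut (X i)) : ℚ) := by
  refine (finsum_eq_of_bijective _ hX fun i => ?_).symm
  obtain ⟨e⟩ := Pi0.out_iso (X i)
  rw [hφ _ _ ⟨e⟩, Nat.card_congr (Aut.autMulEquivOfIso e).toEquiv]

variable {C : Type u} [Category.{v} C] [Abelian C]

/-- An extension as an object of the groupoid of short exact sequences. -/
abbrev Extension.toS2 {A B : C} (E : Extension C A B) : S2 C :=
  ⟨⟨ShortComplex.mk E.i E.p E.zero, E.shortExact⟩⟩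

/-- The morphism of short complexes underlying a morphism in `S₂`. -/
abbrev S2.toHom {X Y : S2 C} (f : X ⟶ Y) : X.of.obj ⟶ Y.of.obj := (seqIncl C).map f.iso.hom

lemma S2.hom_ext {X Y : S2 C} {f g : X ⟶ Y} (h : S2.toHom f = S2.toHom g) : f = g :=
  Core.hom_ext ((seqIncl C).map_injective h)

lemma midFunctor_w {B : C} {X Y : TwoFiber (midFunctor C) ⟨B⟩} (f : X ⟶ Y) :
    (S2.toHom f.left).τ₂ ≫ Y.hom.iso.hom = X.hom.iso.hom :=
  congrArg (fun g => g.iso.hom) (CostructuredArrow.w f)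

/-- The 2-fibers of `F` have no nontrivial automorphisms. -/
instance {B : C} (X : TwoFiber (midFunctor C) ⟨B⟩) : Subsingleton (Aut X) where
  allEq (f g : X ≅ X) := by
    have := X.left.of.property.mono_f
    have := X.left.of.property.epi_g
    have h₂ : (S2.toHom f.hom.left).τ₂ = (S2.toHom g.hom.left).τ₂ :=
      (cancel_mono X.hom.iso.hom).1 ((midFunctor_w f.hom).trans (midFunctor_w g.hom).symm)
    refine Iso.ext (CostructuredArrow.hom_ext _ _ (S2.hom_ext (ShortComplex.hom_ext _ _ ?_ h₂ ?_)))
    · rw [← cancel_mono X.left.of.obj.f, ShortComplex.Hom.comm₁₂, ShortComplex.Hom.comm₁₂, h₂]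
    · rw [← cancel_epi X.left.of.obj.g, ← ShortComplex.Hom.comm₂₃, ← ShortComplex.Hom.comm₂₃, h₂]

/-- A subobject of `B` as an object of the 2-fiber of `F` at `B`. -/
abbrev subobjectFiber {B : C} (S : Subobject B) : TwoFiber (midFunctor C) ⟨B⟩ :=
  CostructuredArrow.mk (Y := (subobjectExt S).toS2) (𝟙 (⟨B⟩ : S1 C))

/-- The isomorphism classes in the 2-fiber of `F` at `B` are the subobjects of `B`. -/
lemma bijective_subobjectFiber (B : C) :
    Function.Bijective fun S : Subobject B => Pi0.mk (subobjectFiber S) := by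
  refine ⟨fun S S' h => ?_, fun c => ?_⟩
  · have key {S S' : Subobject B} (f : subobjectFiber S ⟶ subobjectFiber S') : S ≤ S' := by
      have h₂ : (S2.toHom f.left).τ₂ = 𝟙 B := (Category.comp_id _).symm.trans (midFunctor_w f)
      refine Subobject.le_of_comm (S2.toHom f.left).τ₁ ((S2.toHom f.left).comm₁₂.trans ?_)
      rw [h₂]
      exact Category.comp_id _
    obtain ⟨e⟩ := Pi0.mk_eq_iff.1 h
    exact le_antisymm (key e.hom) (key e.inv)
  · induction c using Quotient.inductionOn with | _ X
    have hS := X.left.of.property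
    have := hS.mono_f
    have := hS.epi_g
    let i₂ : X.left.of.obj.X₂ ≅ B := (Core.inclusion C).mapIso (asIso X.hom)
    let S : Subobject B := Subobject.mk (X.left.of.obj.f ≫ i₂.hom)
    let j : (S : C) ≅ X.left.of.obj.X₁ := Subobject.underlyingIso _
    have hj : j.hom ≫ X.left.of.obj.f = S.arrow ≫ i₂.inv := by
      rw [Iso.eq_comp_inv, Category.assoc]
      exact Subobject.underlyingIso_hom_comp_eq_mk _
    let k : cokernel S.arrow ≅ X.left.of.obj.X₃ :=
      cokernel.mapIso S.arrow X.left.of.obj.f j i₂.symm hj.symm ≪≫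
        IsColimit.coconePointUniqueUpToIso (cokernelIsCokernel _) hS.gIsCokernel
    have hk : cokernel.π X.left.of.obj.f ≫ (IsColimit.coconePointUniqueUpToIso
        (cokernelIsCokernel X.left.of.obj.f) hS.gIsCokernel).hom = X.left.of.obj.g :=
      IsColimit.comp_coconePointUniqueUpToIso_hom (cokernelIsCokernel _) hS.gIsCokernel
        WalkingParallelPair.one
    refine ⟨S, Pi0.mk_eq_iff.2 ⟨CostructuredArrow.isoMk
      (S2.isoMk (X := (subobjectExt S).toS2) (Y := X.left)
        (ShortComplex.isoMk j i₂.symm k hj (by simp [k, hk])))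
      (Core.hom_ext (i₂.inv_hom_id))⟩⟩

/-- The product in the Hall algebra is a sum over subobjects. -/
lemma mul_apply [IsFinitary C] (t : Hall C ⊗[ℚ] Hall C) (B : C) :
    (mul C t).1 ⟨B⟩ =
      ∑ᶠ S : Subobject B, (tensorEquiv (S1 C) (S1 C) t).1 (⟨(S : C)⟩, ⟨cokernel S.arrow⟩) := by
  refine (integral_eq_finsum (A := TwoFiber (midFunctor C) ⟨B⟩)
    (φ := fun X => (tensorEquiv (S1 C) (S1 C) t).1 ((endsFunctor C).obj X.left)) ?_ _
    (bijective_subobjectFiber B)).trans (finsum_congr fun S => ?_)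
  · rintro X Y ⟨e⟩
    exact GFun.congr _ ((CostructuredArrow.proj _ _ ⋙ endsFunctor C).mapIso e)
  · rw [Nat.card_unique, Nat.cast_one, div_one]
    rfl

/-- An extension of `x` by `y` as an object of the 2-fiber of `G'` at `(x, y)`. -/
abbrev Extension.fiber {x y : C} (E : Extension C x y) :
    TwoFiber (endsFunctor' C) (⟨x⟩, ⟨y⟩) :=
  CostructuredArrow.mk (Y := E.toS2) (𝟙 ((⟨x⟩, ⟨y⟩) : S1 C × S1 C))

lemma endsFunctor'_w₁ {x y : C} {X Y : TwoFiber (endsFunctor' C) (⟨x⟩, ⟨y⟩)} (f : X ⟶ Y) :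
    (S2.toHom f.left).τ₁ ≫ Y.hom.2.iso.hom = X.hom.2.iso.hom :=
  congrArg (fun g => g.2.iso.hom) (CostructuredArrow.w f)

lemma endsFunctor'_w₃ {x y : C} {X Y : TwoFiber (endsFunctor' C) (⟨x⟩, ⟨y⟩)} (f : X ⟶ Y) :
    (S2.toHom f.left).τ₃ ≫ Y.hom.1.iso.hom = X.hom.1.iso.hom :=
  congrArg (fun g => g.1.iso.hom) (CostructuredArrow.w f)

/-- Isomorphisms in the 2-fibers of `G'` are equivalences of extensions. -/
def Extension.fiberIsoEquiv {x y : C} (E E' : Extension C x y) :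
    (E.fiber ≅ E'.fiber) ≃ ExtHom (𝟙 x) E E' where
  toFun e :=
    { hom := (S2.toHom e.hom.left).τ₂
      i_hom := by
        have h₁ : (S2.toHom e.hom.left).τ₁ ≫ 𝟙 y = 𝟙 y := endsFunctor'_w₁ e.hom
        have h := (S2.toHom e.hom.left).comm₁₂
        rw [(Category.comp_id _).symm.trans h₁] at h
        exact h.symm.trans (Category.id_comp _)
      hom_p := by
        have h₃ : (S2.toHom e.hom.left).τ₃ ≫ 𝟙 x = 𝟙 x := endsFunctor'_w₃ e.hom
        have h := (S2.toHom e.hom.left).comm₂₃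
        rwa [(Category.comp_id _).symm.trans h₃] at h }
  invFun k :=
    have := k.isIso
    CostructuredArrow.isoMk (S2.isoMk (X := E.toS2) (Y := E'.toS2)
      (ShortComplex.isoMk (Iso.refl _) (asIso k.hom) (Iso.refl _) (by simp) (by simp)))
      (Prod.ext (Core.hom_ext (Category.comp_id (𝟙 x))) (Core.hom_ext (Category.comp_id (𝟙 y))))
  left_inv e := by
    refine Iso.ext (CostructuredArrow.hom_ext _ _ (S2.hom_ext (ShortComplex.hom_ext _ _ ?_ rfl ?_)))
    · exact ((Category.comp_id _).symm.trans (endsFunctor'_w₁ e.hom)).symm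
    · exact ((Category.comp_id _).symm.trans (endsFunctor'_w₃ e.hom)).symm
  right_inv k := rfl

/-- The isomorphism classes in the 2-fiber of `G'` at `(x, y)` are the classes of extensions. -/
lemma bijective_fiber (x y : C) :
    Function.Bijective fun c : ExtensionClasses C x y => Pi0.mk c.out.fiber := by
  refine ⟨fun c c' h => ?_, fun d => ?_⟩
  · obtain ⟨e⟩ := Pi0.mk_eq_iff.1 h
    rw [← c.mk_out, ← c'.mk_out]
    exact ExtensionClasses.mk_eq_mk_iff.2 ⟨Extension.fiberIsoEquiv _ _ e⟩
  · induction d using Quotient.inductionOn with | _ X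
    let i₁ : X.left.of.obj.X₁ ≅ y := (Core.inclusion C).mapIso (asIso X.hom.2)
    let i₃ : X.left.of.obj.X₃ ≅ x := (Core.inclusion C).mapIso (asIso X.hom.1)
    have hz : (i₁.inv ≫ X.left.of.obj.f) ≫ (X.left.of.obj.g ≫ i₃.hom) = 0 := by simp
    let e : X.left.of.obj ≅ ShortComplex.mk (i₁.inv ≫ X.left.of.obj.f)
        (X.left.of.obj.g ≫ i₃.hom) hz :=
      ShortComplex.isoMk i₁ (Iso.refl _) i₃ (by simp) (by simp)
    let E : Extension C x y :=
      { X := X.left.of.obj.X₂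
        i := i₁.inv ≫ X.left.of.obj.f
        p := X.left.of.obj.g ≫ i₃.hom
        zero := hz
        shortExact := ShortComplex.shortExact_of_iso e X.left.of.property }
    obtain ⟨k⟩ := ExtensionClasses.mk_eq_mk_iff.1 (ExtensionClasses.mk E).mk_out
    refine ⟨ExtensionClasses.mk E, Pi0.mk_eq_iff.2 ⟨(Extension.fiberIsoEquiv _ _).symm k ≪≫
      CostructuredArrow.isoMk (S2.isoMk (X := E.toS2) (Y := X.left) e.symm)
        (Prod.ext (Core.hom_ext i₃.inv_hom_id) (Core.hom_ext i₁.inv_hom_id))⟩⟩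

/-- The coproduct in the Hall algebra is a sum over `Ext¹`. -/
lemma comul_apply [IsFinitary C] [IsCofinitary C] (φ : Hall C) (x y : C) :
    (tensorEquiv (S1 C) (S1 C) (comul C φ)).1 (⟨x⟩, ⟨y⟩) =
      (∑ᶠ c : ExtensionClasses C x y, φ.1 ⟨c.out.X⟩) / Nat.card (x ⟶ y) := by
  refine (congrArg (fun f : GFun (S1 C × S1 C) => f.1 (⟨x⟩, ⟨y⟩))
    ((tensorEquiv (S1 C) (S1 C)).apply_symm_apply _)).trans ?_
  refine (integral_eq_finsum (A := TwoFiber (endsFunctor' C) (⟨x⟩, ⟨y⟩))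
    (φ := fun X => φ.1 ((midFunctor C).obj X.left)) ?_ _ (bijective_fiber x y)).trans ?_
  · rintro X Y ⟨e⟩
    exact GFun.congr _ ((CostructuredArrow.proj _ _ ⋙ midFunctor C).mapIso e)
  · have := Fintype.ofFinite (ExtensionClasses C x y)
    rw [finsum_eq_sum_of_fintype, finsum_eq_sum_of_fintype, Finset.sum_div]
    refine Finset.sum_congr rfl fun c _ => ?_
    have h : Nat.card (Aut c.out.fiber) = Nat.card (x ⟶ y) :=
      Nat.card_congr ((Extension.fiberIsoEquiv c.out c.out).trans
        (ExtHom.equivHom ⟨𝟙 _, by simp, by simp⟩).symm)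
    rw [h]
    rfl

/-- The twisted product on `H ⊗ H` is a sum over pairs of subobjects. -/
lemma twistedMul_apply [HasExt.{w} C] [IsFinitary C] [IsCofinitary C]
    (s t : Hall C ⊗[ℚ] Hall C) (x y : C) :
    (tensorEquiv (S1 C) (S1 C) (twistedMul.{w} C (s ⊗ₜ[ℚ] t))).1 (⟨x⟩, ⟨y⟩) =
      ∑ᶠ x₁ : Subobject x, ∑ᶠ y₁ : Subobject y, twist.{w} C (cokernel x₁.arrow) y₁ *
        (tensorEquiv (S1 C) (S1 C) s).1 (⟨(x₁ : C)⟩, ⟨(y₁ : C)⟩) *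
        (tensorEquiv (S1 C) (S1 C) t).1 (⟨cokernel x₁.arrow⟩, ⟨cokernel y₁.arrow⟩) := by
  have (A : C) := Fintype.ofFinite (Subobject A)
  simp only [finsum_eq_sum_of_fintype]
  -- both sides are bilinear in `s` and `t`, so indicator functions suffice
  have hspan : ∀ s : Hall C ⊗[ℚ] Hall C, s ∈ Submodule.span ℚ
      (Set.range fun p : S1 C × S1 C => indicator p.1 ⊗ₜ[ℚ] indicator p.2) := fun s => by
    have h := ((indicatorBasis (S1 C)).tensorProduct (indicatorBasis (S1 C))).mem_span s
    refine Submodule.span_mono ?_ h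
    rintro _ ⟨⟨c, d⟩, rfl⟩
    have hb (c : Pi0 (S1 C)) : indicator c.out = indicatorBasis (S1 C) c := by
      rw [← indicatorBasis_mk, Pi0.mk_out]
    refine ⟨(c.out, d.out), ?_⟩
    rw [Module.Basis.tensorProduct_apply, ← hb, ← hb]
  induction hspan s using Submodule.span_induction with
  | zero => simp
  | add s s' _ _ hs hs' =>
    simp [TensorProduct.add_tmul, hs, hs', mul_add, add_mul, Finset.sum_add_distrib]
  | smul r s _ hs =>
    rw [← TensorProduct.smul_tmul']
    simp [hs, Finset.mul_sum, mul_assoc, mul_left_comm r]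
  | mem s hs =>
  obtain ⟨⟨A, B⟩, rfl⟩ := hs
  induction hspan t using Submodule.span_induction with
  | zero => simp
  | add s s' _ _ hs hs' =>
    simp [TensorProduct.tmul_add, hs, hs', mul_add, Finset.sum_add_distrib]
  | smul r s _ hs =>
    rw [TensorProduct.tmul_smul]
    simp [hs, Finset.mul_sum, mul_left_comm r]
  | mem s hs =>
  obtain ⟨⟨A', B'⟩, rfl⟩ := hs
  rw [twistedMul_indicator, map_smul]
  change _ * (tensorEquiv (S1 C) (S1 C) _).1 (⟨x⟩, ⟨y⟩) = _
  rw [tensorEquiv_tmul_apply, mul_apply, mul_apply, finsum_eq_sum_of_fintype,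
    finsum_eq_sum_of_fintype, Finset.sum_mul_sum, Finset.mul_sum]
  refine Finset.sum_congr rfl fun x₁ _ => ?_
  rw [Finset.mul_sum]
  refine Finset.sum_congr rfl fun y₁ _ => ?_
  simp only [tensorEquiv_tmul_apply]
  -- where the indicator functions do not vanish, the twist has its value at `A'` and `B`
  by_cases h₁ : Nonempty ((⟨cokernel x₁.arrow⟩ : S1 C) ≅ A')
  · by_cases h₂ : Nonempty ((⟨(y₁ : C)⟩ : S1 C) ≅ B)
    · have h : twist.{w} C (cokernel x₁.arrow) y₁ = twist.{w} C A'.of B.of :=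
        twist_congr C ((Core.inclusion C).mapIso h₁.some) ((Core.inclusion C).mapIso h₂.some)
      rw [h, twist]
      ring
    · have h : (indicator B).1 (⟨(y₁ : C)⟩ : S1 C) = 0 := if_neg h₂
      simp [h]
  · have h : (indicator A').1 (⟨cokernel x₁.arrow⟩ : S1 C) = 0 := if_neg h₁
    simp [h]

end Evaluation

end

end HallGreen

theorem mainTheorem3 {C : Type u} [Category.{v} C] [Abelian C] [HasExt.{w} C]
    [HallGreen.IsFinitary C] [HallGreen.IsCofinitary C] [HallGreen.IsHereditary.{w} C] :
    HallGreen.twistedMul.{w} C ∘ₗ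
        TensorProduct.map (HallGreen.comul C) (HallGreen.comul C) =
      HallGreen.comul C ∘ₗ HallGreen.mul C := by
  refine TensorProduct.ext' fun φ ψ =>
    (HallGreen.tensorEquiv (HallGreen.S1 C) (HallGreen.S1 C)).injective (Subtype.ext (funext ?_))
  rintro ⟨⟨x⟩, ⟨y⟩⟩
  simp only [LinearMap.comp_apply, TensorProduct.map_tmul]
  rw [HallGreen.twistedMul_apply, HallGreen.comul_apply]
  simp only [HallGreen.comul_apply, HallGreen.mul_apply, HallGreen.tensorEquiv_tmul_apply]
  exact (HallGreen.finsum_subobject.{w} (φ := fun A => φ.1 ⟨A⟩) (ψ := fun A => ψ.1 ⟨A⟩)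
    (fun _ _ e => HallGreen.GFun.congr φ (Core.isoMk e))
    (fun _ _ e => HallGreen.GFun.congr ψ (Core.isoMk e)) x y).symm
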